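/- Setting. Let $X_1,\dots,X_N$ be the variables of a causal graphical model with acyclic graph $\mathcal G$ and no latent confounders. The $X_i$ take values in arbitrary measurable spaces with $\sigma$-finite reference measures. The observational law has density $p(x)=\prod_i p(x_i\mid x_{\mathrm{pa}(i)})$. The perfect intervention $I_{X_k}$ replaces the factor $p(x_k\mid x_{\mathrm{pa}(k)})$ by a density $q_k(x_k)$. All these densities are measurable and positive. Below, $p(x_j\mid x_S)$ always denotes the conditional density of the observational law. For $i\ne j$, $k\neq j$ and $S\subseteq\{1,\dots,N\}\setminus\{i,j\}$ let $$g_k(i,j;S)=\mathbb E_{I_{X_k}}\big[\log p(X_j\mid X_S,X_i)-\log p(X_j\mid X_S)\big],$$ and assume that all these expectations exist and are finite. Interventions on $X_k$ are chosen with probability $p_k>0$, $\sum_k p_k=1$. Let $\lambda_{\mathrm{sparse}}>0$, let $\sigma$ be the sigmoid function, and let $\eta_\gamma,\eta_\theta>0$ be step sizes. Dynamics (ENCO with exactly modelled conditionals and infinite data). Given real parameters $\gamma_{ij},\theta_{ij}$ with $\theta_{ij}=-\theta_{ji}$, a random graph contains each edge $X_i\to X_j$ $(i\neq j)$ independently with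 probability $\sigma(\gamma_{ij})\sigma(\theta_{ij})$. Let $\Delta_k(i,j)=-\mathbb E_S[g_k(i,j;S)]$, where $S$ is the random set of parents of $X_j$ other than $X_i$. From any starting point, iterate for all $i\ne j$ simultaneously $$\gamma_{ij}\leftarrow\gamma_{ij}-\eta_\gamma\,\sigma'(\gamma_{ij})\,\sigma(\theta_{ij})\sum_{k\neq j}p_k\big(\Delta_k(i,j)+\lambda_{\mathrm{sparse}}\big),$$ $$\theta_{ij}\leftarrow\theta_{ij}-\eta_\theta\,\sigma'(\theta_{ij})\big(p_i\,\sigma(\gamma_{ij})\,\Delta_i(i,j)-p_j\,\sigma(\gamma_{ji})\,\Delta_j(j,i)\big).$$ Conditions. For every edge $X_i\to X_j$ of $\mathcal G$: 1. $g_i(i,j;S)\ge 0$ for all $S\subseteq\{1,\dots,N\}\setminus\{i,j\}$; 2. $g_i(i,j;S)>0$ for at least one such $S$ that has positive probability of being sampled (at the starting point) as the set of parents of $X_j$ other than $X_i$; 3. $\displaystyle\min_{S\subseteq \mathrm{gpa}_i(X_j)}\ \frac{1}{1-p_j}\sum_{k\ne j}p_k\,g_k(i,j;S)>\lambda_{\mathrm{sparse}}$,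 where $\mathrm{gpa}_i(X_j)$ is the set of nodes other than $X_i$ that could have an edge to $X_j$ without introducing a cycle into $\mathcal G$. Moreover, conditions 1 and 2 hold for every other pair $(i,j)$ for which $X_j$ is a descendant of $X_i$ in $\mathcal G$. Theorem. Under these assumptions the iteration converges to $\mathcal G$ from every starting point (in particular there are no spurious local optima to converge to): - $\sigma(\theta_{ij})\to1$ and $\sigma(\gamma_{ij})\to1$ for every edge $X_i\to X_j$ of $\mathcal G$; - $\sigma(\gamma_{ij})\sigma(\theta_{ij})\to0$ for all $i\neq j$ such that $X_i\to X_j$ is not an edge of $\mathcal G$; - $\sigma(\theta_{ij})\to1$ whenever $X_i$ is an ancestor of $X_j$ and, in the observational law, $X_i$ and $X_j$ are not conditionally independent given the parents of $X_i$; - after finitely many steps the returned graph $\{X_i\to X_j: i\ne j,\ \sigma(\gamma_{ij})>\tfrac12,\ \sigma(\theta_{ij})>\tfrac12\}$ equals $\mathcal G$ and remains so. -/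

import Mathlib

open MeasureTheory Filter Topology
open scoped ENNReal NNReal

namespace ENCO

/-- A directed graph, given by its edge relation, is acyclic. -/
def Acyclic {ι : Type*} (G : ι → ι → Prop) : Prop :=
  ∀ i, ¬ Relation.TransGen G i i

/-- A causal graphical model on the variables `X_i : Ω i`, `i : ι`, all of them observed and without
latent confounders: an acyclic graph, for every variable a causal mechanism `p(x_i | x_pa(i))`, and
for every variable the distribution from which a perfect intervention on it draws its value.
Mechanisms and intervention distributions are given by densities with respect to arbitrary
reference measures `μ i` (so the variables may be discrete, continuous or mixed). The densities are
positive: no configuration of values is excluded in the observational or in an interventional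
regime, so that all conditionals are well defined under every intervention. -/
structure CGM {ι : Type*} [Fintype ι] (Ω : ι → Type*) [∀ i, MeasurableSpace (Ω i)]
    [DecidableEq ι] (μ : ∀ i, Measure (Ω i)) where
  /-- `Edge i j` means `X_i → X_j`. -/
  Edge : ι → ι → Prop
  acyclic : Acyclic Edge
  /-- `mech i x` is `p(x_i | x_pa(i))`. -/
  mech : ι → (∀ k, Ω k) → ℝ≥0
  mech_measurable : ∀ i, Measurable (mech i)
  /-- The mechanism of `X_i` reads only `x_i` and the values of the parents of `X_i`. -/
  mech_dependsOn : ∀ i, DependsOn (mech i) {k | k = i ∨ Edge k i}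
  mech_pos : ∀ i x, 0 < mech i x
  mech_normalized : ∀ i x, ∫⁻ t, (mech i (Function.update x i t) : ℝ≥0∞) ∂(μ i) = 1
  /-- `interv i` is the density of `X_i` under the intervention on `X_i`. -/
  interv : ∀ i, Ω i → ℝ≥0
  interv_measurable : ∀ i, Measurable (interv i)
  interv_pos : ∀ i t, 0 < interv i t
  interv_normalized : ∀ i, ∫⁻ t, (interv i t : ℝ≥0∞) ∂(μ i) = 1

namespace CGM

variable {ι : Type*} [Fintype ι] [DecidableEq ι] {Ω : ι → Type*} [∀ i, MeasurableSpace (Ω i)]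
  {μ : ∀ i, Measure (Ω i)}

/-- `X_i` is an ancestor of `X_j`, that is, `X_j` is a descendant of `X_i`. -/
def Ancestor (M : CGM Ω μ) (i j : ι) : Prop := Relation.TransGen M.Edge i j

/-- The set of parents of `X_i`. -/
noncomputable def pa (M : CGM Ω μ) (i : ι) : Finset ι :=
  open Classical in Finset.univ.filter fun k => M.Edge k i

/-- The nodes other than `X_i` that could have an edge to `X_j` without introducing a cycle into
the graph. -/
def gpa (M : CGM Ω μ) (i j : ι) : Set ι :=
  {k | k ≠ i ∧ Acyclic fun a b => M.Edge a b ∨ (a = k ∧ b = j)}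

/-- The observational joint density, by the Markov factorization. -/
noncomputable def obsDensity (M : CGM Ω μ) (x : ∀ k, Ω k) : ℝ≥0∞ :=
  ∏ i, (M.mech i x : ℝ≥0∞)

/-- The joint density under the perfect intervention on `X_k`: the mechanism of `X_k` is replaced,
the other mechanisms are kept. -/
noncomputable def intDensity (M : CGM Ω μ) (k : ι) (x : ∀ k, Ω k) : ℝ≥0∞ :=
  M.interv k (x k) * ∏ i ∈ Finset.univ.erase k, (M.mech i x : ℝ≥0∞)

/-- The joint distribution of all variables under the intervention on `X_k`. -/
noncomputable def intMeasure (M : CGM Ω μ) (k : ι) : Measure (∀ k, Ω k) :=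
  (Measure.pi μ).withDensity (M.intDensity k)

/-- The observational marginal density `p(x_S)`. -/
noncomputable def margDensity (M : CGM Ω μ) (S : Finset ι) (x : ∀ k, Ω k) : ℝ≥0∞ :=
  lmarginal μ Sᶜ M.obsDensity x

/-- The observational conditional log-likelihood `log p(x_j | x_S)`. -/
noncomputable def logLik (M : CGM Ω μ) (j : ι) (S : Finset ι) (x : ∀ k, Ω k) : ℝ :=
  Real.log (M.margDensity (insert j S) x / M.margDensity S x).toReal

/-- The gain `log p(x_j | x_S, x_i) - log p(x_j | x_S)` from adding `X_i` to the candidate parent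
set `S` of `X_j`. -/
noncomputable def llGain (M : CGM Ω μ) (i j : ι) (S : Finset ι) (x : ∀ k, Ω k) : ℝ :=
  M.logLik j (insert i S) x - M.logLik j S x

/-- The expectation of the gain `llGain` under the intervention on `X_k`. -/
noncomputable def expGain (M : CGM Ω μ) (k i j : ι) (S : Finset ι) : ℝ :=
  ∫ x, M.llGain i j S x ∂(M.intMeasure k)

/-- All expected log-likelihood gains of `X_j` under interventions on other variables exist and are
finite. -/
def FiniteGains (M : CGM Ω μ) : Prop :=
  ∀ (i j k : ι) (S : Finset ι), i ≠ j → k ≠ j → i ∉ S → j ∉ S →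
    Integrable (M.llGain i j S) (M.intMeasure k)

/-- In the observational distribution, `X_j` and `X_i` are conditionally independent given `X_S`:
`p(x_j | x_S, x_i) = p(x_j | x_S)` almost everywhere. -/
def CondIndep (M : CGM Ω μ) (i j : ι) (S : Finset ι) : Prop :=
  ∀ᵐ x ∂(Measure.pi μ), M.llGain i j S x = 0

end CGM

/-- The derivative `σ' = σ (1 - σ)` of the sigmoid. -/
noncomputable def dsigmoid (x : ℝ) : ℝ := Real.sigmoid x * (1 - Real.sigmoid x)

section Parameters

variable {ι : Type*} [Fintype ι] [DecidableEq ι]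

/-- The probability `σ(γ_ij) σ(θ_ij)` of the edge `X_i → X_j`. -/
noncomputable def edgeProb (γ θ : ι → ι → ℝ) (i j : ι) : ℝ :=
  Real.sigmoid (γ i j) * Real.sigmoid (θ i j)

/-- The probability that, apart from `X_i`, exactly the nodes in `S` are the parents of `X_j` in a
graph sampled with independent edges of probabilities `edgeProb γ θ`. -/
noncomputable def parentProb (γ θ : ι → ι → ℝ) (i j : ι) (S : Finset ι) : ℝ :=
  (∏ k ∈ S, edgeProb γ θ k j) * ∏ k ∈ (Finset.univ \ {i, j}) \ S, (1 - edgeProb γ θ k j)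

/-- The graph returned for the parameters `γ`, `θ`: the edges with both probabilities above 1/2. -/
def Predicted (γ θ : ι → ι → ℝ) (i j : ι) : Prop :=
  i ≠ j ∧ 1 / 2 < Real.sigmoid (γ i j) ∧ 1 / 2 < Real.sigmoid (θ i j)

variable {Ω : ι → Type*} [∀ i, MeasurableSpace (Ω i)] {μ : ∀ i, Measure (Ω i)}

/-- The expectation of `L_{X_i → X_j}(X_j) - L_{X_i ↛ X_j}(X_j)` over data from the intervention on
`X_k` and over sampled graphs without regard to the edge `X_i → X_j`, where `L` is the negative
log-likelihood of `X_j` given its sampled parents (under the observational conditionals). -/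
noncomputable def nllDiff (M : CGM Ω μ) (γ θ : ι → ι → ℝ) (k i j : ι) : ℝ :=
  ∑ S ∈ (Finset.univ \ {i, j}).powerset, parentProb γ θ i j S * -M.expGain k i j S

/-- The expected update direction of `γ_ij`, over interventions drawn from `p`; a step in which
`X_j` is intervened on does not update `γ_ij`. -/
noncomputable def gradγ (M : CGM Ω μ) (p : ι → ℝ) (lam : ℝ) (γ θ : ι → ι → ℝ) (i j : ι) : ℝ :=
  dsigmoid (γ i j) * Real.sigmoid (θ i j) *
    ∑ k ∈ Finset.univ.erase j, p k * (nllDiff M γ θ k i j + lam)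

/-- The expected update direction of `θ_ij`, which uses only interventions on `X_i` and `X_j`. -/
noncomputable def gradθ (M : CGM Ω μ) (p : ι → ℝ) (γ θ : ι → ι → ℝ) (i j : ι) : ℝ :=
  dsigmoid (θ i j) *
    (p i * Real.sigmoid (γ i j) * nllDiff M γ θ i i j
      - p j * Real.sigmoid (γ j i) * nllDiff M γ θ j j i)

/-- The parameters `γ t`, `θ t`, `t = 0, 1, 2, …`, evolve by the gradient steps of graph fitting,
with step sizes `ηγ`, `ηθ`, from an arbitrary start with `θ_ij = -θ_ji` (a relation that the steps
preserve). -/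
structure IsTrajectory (M : CGM Ω μ) (p : ι → ℝ) (lam ηγ ηθ : ℝ) (γ θ : ℕ → ι → ι → ℝ) : Prop where
  init_antisymm : ∀ i j, θ 0 i j = -θ 0 j i
  step_γ : ∀ t i j, i ≠ j → γ (t + 1) i j = γ t i j - ηγ * gradγ M p lam (γ t) (θ t) i j
  step_θ : ∀ t i j, i ≠ j → θ (t + 1) i j = θ t i j - ηθ * gradθ M p (γ t) (θ t) i j

/-- Adding `X_i` to any candidate parent set of `X_j` never lowers the expected log-likelihood of
`X_j` under the intervention on `X_i`. -/
def Condition1 (M : CGM Ω μ) (i j : ι) : Prop :=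
  ∀ S : Finset ι, i ∉ S → j ∉ S → 0 ≤ M.expGain i i j S

/-- For some candidate parent set that is sampled with positive probability under the parameters
`γ`, `θ`, the gain in `Condition1` is positive. -/
def Condition2 (M : CGM Ω μ) (γ θ : ι → ι → ℝ) (i j : ι) : Prop :=
  ∃ S : Finset ι, i ∉ S ∧ j ∉ S ∧ 0 < parentProb γ θ i j S ∧ 0 < M.expGain i i j S

/-- For every parent set in `gpa_i(X_j)`, the gain from `X_i`, averaged over the interventions on
variables other than `X_j`, exceeds `lam`. -/
def Condition3 (M : CGM Ω μ) (p : ι → ℝ) (lam : ℝ) (i j : ι) : Prop :=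
  ∀ S : Finset ι, (S : Set ι) ⊆ M.gpa i j →
    lam < (∑ k ∈ Finset.univ.erase j, p k * M.expGain k i j S) / ∑ k ∈ Finset.univ.erase j, p k

end Parameters

end ENCO

/-! Under the intervention on X_j, X_j is independent of its non-descendants, whose law is
unchanged. If X_i and X_S are non-descendants of X_j, the ratio r = p(x_i | x_S, x_j) / p(x_i | x_S)
therefore has interventional mean at most 1. Since log r ≤ r - 1, adding X_j to the predictors of
X_i cannot pay: the gain is strictly negative unless X_i and X_j are independent given X_S, and then
it vanishes under every intervention (`CGM.expGain_anticausal`).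

For an ancestor X_i of X_j, the wrong edge X_j → X_i is thus pushed down through θ where this gain
is negative, and through γ by the sparsity penalty where it is zero. The two effects have to be
combined, because γ may grow while θ falls. The damping is such that one step changes θ + exp θ and
γ + exp γ by at most σ(γ)σ(θ) times a bound on the respective drift, up to factors exp(±R). So for
large K the potential K(θ + exp θ) + (γ + exp γ) eventually decreases by a fixed multiple of the
edge probability in every step. Whether the potential tends to -∞ or converges, the edge probability
tends to 0, for any step sizes (`tendsto_sigmoid_mul_sigmoid_zero`). Parent sets containing
descendants of X_j are removed by induction from the sinks upward
(`IsTrajectory.edgeProb_anticausal`).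

The sampled parents of X_j are then asymptotically non-descendants. For a true edge, Condition 3
excludes conditional independence, so θ_ij is pushed up. Its drift carries σ(γ_ji), which may decay,
but no faster than 1/t, and the harmonic series diverges (`IsTrajectory.tendsto_θ`). Then γ_ij grows
by Condition 3. With all true parents present, the Markov property makes any other non-descendant
redundant, and the penalty removes it. The sampled parents thus concentrate on the true ones, which
settles the remaining orientations. -/

namespace ENCO

/-! ### Real dynamics with sigmoid-damped increments -/

/-- The larger of the two dilations of `a` by `exp R` and `exp (-R)`. -/
noncomputable def dilate (R a : ℝ) : ℝ := max (Real.exp R * a) (Real.exp (-R) * a)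

lemma dilate_mono (R : ℝ) {a b : ℝ} (h : a ≤ b) : dilate R a ≤ dilate R b :=
  max_le_max (mul_le_mul_of_nonneg_left h (Real.exp_pos _).le)
    (mul_le_mul_of_nonneg_left h (Real.exp_pos _).le)

lemma dilate_mul (R a : ℝ) {c : ℝ} (hc : 0 ≤ c) : dilate R (c * a) = c * dilate R a := by
  unfold dilate
  rw [mul_max_of_nonneg _ _ hc]
  congr 1 <;> ring

lemma le_dilate {R : ℝ} (hR : 0 ≤ R) (a : ℝ) : a ≤ dilate R a := by
  unfold dilate
  rcases le_total 0 a with h | h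
  · exact le_max_of_le_left (le_mul_of_one_le_left h (Real.one_le_exp hR))
  · refine le_max_of_le_right ?_
    have : Real.exp (-R) ≤ 1 := Real.exp_le_one_iff.2 (by linarith)
    nlinarith

lemma dilate_of_nonpos {R a : ℝ} (hR : 0 ≤ R) (ha : a ≤ 0) :
    dilate R a = Real.exp (-R) * a := by
  refine max_eq_right ?_
  have : Real.exp (-R) ≤ Real.exp R := Real.exp_le_exp.2 (by linarith)
  nlinarith

/-- Jensen's inequality: a maximum of two linear functions is convex and positively homogeneous. It
turns bounds for each parent set into bounds for the mean drift. -/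
lemma dilate_sum_le {α : Type*} (s : Finset α) (R : ℝ) (w f : α → ℝ) (hw : ∀ S ∈ s, 0 ≤ w S) :
    dilate R (∑ S ∈ s, w S * f S) ≤ ∑ S ∈ s, w S * dilate R (f S) := by
  unfold dilate
  refine max_le ?_ ?_ <;> rw [Finset.mul_sum] <;> refine Finset.sum_le_sum fun S hS => ?_
  · rw [mul_left_comm]; exact mul_le_mul_of_nonneg_left (le_max_left _ _) (hw S hS)
  · rw [mul_left_comm]; exact mul_le_mul_of_nonneg_left (le_max_right _ _) (hw S hS)

/-- The slope of exp between 0 and d lies between exp (-R) and exp R; the sign of d decides which of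
the two gives the upper bound. -/
lemma exp_sub_one_le_dilate {R d : ℝ} (hd : |d| ≤ R) : Real.exp d - 1 ≤ dilate R d := by
  have h1 : Real.exp d - 1 ≤ Real.exp d * d := by
    have := Real.add_one_le_exp (-d)
    have h2 : Real.exp d * Real.exp (-d) = 1 := by rw [← Real.exp_add]; simp
    nlinarith [Real.exp_pos d]
  refine h1.trans ?_
  obtain ⟨hl, hu⟩ := abs_le.1 hd
  rcases le_total 0 d with h | h
  · exact le_max_of_le_left (mul_le_mul_of_nonneg_right (Real.exp_le_exp.2 hu) h)
  · exact le_max_of_le_right (mul_le_mul_of_nonpos_right (Real.exp_le_exp.2 hl) h)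

/-- The increment of the convex function `x + exp x` over a bounded step. -/
lemma add_exp_step_le {R d : ℝ} (x : ℝ) (hd : |d| ≤ R) :
    (x + d + Real.exp (x + d)) - (x + Real.exp x) ≤ (1 + Real.exp x) * dilate R d := by
  have h1 := exp_sub_one_le_dilate hd
  have h2 := le_dilate ((abs_nonneg d).trans hd) d
  rw [Real.exp_add]
  nlinarith [Real.exp_pos x]

lemma one_sub_sigmoid (x : ℝ) : 1 - Real.sigmoid x = (1 + Real.exp x)⁻¹ := by
  rw [← Real.sigmoid_neg, Real.sigmoid_def, neg_neg]

/-- This identity dictates the potential: the derivative of x + exp x turns the damping σ' into σ.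
-/
lemma one_add_exp_mul_dsigmoid (x : ℝ) : (1 + Real.exp x) * dsigmoid x = Real.sigmoid x := by
  have : (1 + Real.exp x) ≠ 0 := by positivity
  rw [dsigmoid, one_sub_sigmoid]
  field_simp

lemma dsigmoid_pos (x : ℝ) : 0 < dsigmoid x :=
  mul_pos (Real.sigmoid_pos x) (sub_pos.2 (Real.sigmoid_lt_one x))

lemma dsigmoid_le_sigmoid (x : ℝ) : dsigmoid x ≤ Real.sigmoid x := by
  have := Real.sigmoid_pos x
  unfold dsigmoid; nlinarith

lemma dsigmoid_le_one (x : ℝ) : dsigmoid x ≤ 1 :=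
  (dsigmoid_le_sigmoid x).trans (Real.sigmoid_le_one x)

lemma dsigmoid_neg (x : ℝ) : dsigmoid (-x) = dsigmoid x := by
  unfold dsigmoid; rw [Real.sigmoid_neg]; ring

lemma continuous_dsigmoid : Continuous dsigmoid :=
  continuous_sigmoid.mul (continuous_const.sub continuous_sigmoid)

lemma sigmoid_le_exp (x : ℝ) : Real.sigmoid x ≤ Real.exp x := by
  rw [Real.sigmoid_def, inv_le_comm₀ (by positivity) (Real.exp_pos x), ← Real.exp_neg]
  linarith

/-- The product is at most the exponential of the smaller argument, which lies below every weighted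
mean of the two. -/
lemma sigmoid_mul_sigmoid_le {K : ℝ} (hK : 0 ≤ K) (x y : ℝ) :
    Real.sigmoid x * Real.sigmoid y ≤ Real.exp ((K * y + x) / (1 + K)) := by
  have hx : Real.sigmoid x * Real.sigmoid y ≤ Real.exp x :=
    (mul_le_of_le_one_right (Real.sigmoid_nonneg x) (Real.sigmoid_le_one y)).trans
      (sigmoid_le_exp x)
  have hy : Real.sigmoid x * Real.sigmoid y ≤ Real.exp y :=
    (mul_le_of_le_one_left (Real.sigmoid_nonneg y) (Real.sigmoid_le_one x)).trans
      (sigmoid_le_exp y)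
  rcases le_total x y with h | h
  · refine hx.trans (Real.exp_le_exp.2 ?_)
    rw [le_div_iff₀ (by linarith)]; nlinarith
  · refine hy.trans (Real.exp_le_exp.2 ?_)
    rw [le_div_iff₀ (by linarith)]; nlinarith

/-- If a potential bounding the product from above decreases by a multiple of the product in each
step, then the product tends to zero. -/
lemma tendsto_zero_of_potential {V s : ℕ → ℝ} {C δ : ℝ} (hC : 0 < C) (hδ : 0 < δ)
    (hs : ∀ t, 0 ≤ s t) (hsV : ∀ t, s t ≤ Real.exp (V t / C))
    (hV : ∀ᶠ t in atTop, V (t + 1) - V t ≤ -δ * s t) : Tendsto s atTop (𝓝 0) := by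
  obtain ⟨T, hT⟩ := eventually_atTop.1 hV
  rw [← tendsto_add_atTop_iff_nat T]
  have hstep : ∀ t, V (t + 1 + T) - V (t + T) ≤ -δ * s (t + T) := fun t => by
    rw [add_right_comm]
    exact hT (t + T) (Nat.le_add_left T t)
  have hanti : Antitone fun t => V (t + T) := antitone_nat_of_succ_le fun t => by
    have := hstep t
    nlinarith [hs (t + T)]
  rcases tendsto_atTop_of_antitone hanti with h | ⟨l, h⟩
  · refine squeeze_zero (fun t => hs _) (fun t => hsV _) ?_
    exact Real.tendsto_exp_atBot.comp (h.atBot_div_const hC)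
  · have h' : Tendsto (fun t => (V (t + T) - V (t + 1 + T)) / δ) atTop (𝓝 0) := by
      have := (h.sub ((tendsto_add_atTop_iff_nat 1).2 h)).div_const δ
      simpa using this
    refine squeeze_zero (fun t => hs _) (fun t => ?_) h'
    rw [le_div_iff₀ hδ]
    linarith [hstep t]

/-- Two coupled sigmoid-damped sequences: if a weighted combination of their drifts is eventually
bounded away from zero from above, then the product of their sigmoids vanishes. -/
theorem tendsto_sigmoid_mul_sigmoid_zero {x y a b b' : ℕ → ℝ} {K R δ : ℝ} (hK : 0 ≤ K)
    (hδ : 0 < δ)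
    (hx : ∀ t, x (t + 1) = x t + dsigmoid (x t) * Real.sigmoid (y t) * a t)
    (hy : ∀ t, y (t + 1) = y t + dsigmoid (y t) * b t)
    (ha : ∀ t, |a t| ≤ R) (hbR : ∀ t, |b t| ≤ R) (hb : ∀ t, b t ≤ Real.sigmoid (x t) * b' t)
    (hev : ∀ᶠ t in atTop, K * dilate R (b' t) + dilate R (a t) ≤ -δ) :
    Tendsto (fun t => Real.sigmoid (x t) * Real.sigmoid (y t)) atTop (𝓝 0) := by
  refine tendsto_zero_of_potential (C := 1 + K) (δ := δ)
    (V := fun t => K * (y t + Real.exp (y t)) + (x t + Real.exp (x t))) (by linarith) hδ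
    (fun t => (mul_pos (Real.sigmoid_pos _) (Real.sigmoid_pos _)).le) (fun t => ?_) ?_
  · refine (sigmoid_mul_sigmoid_le hK _ _).trans (Real.exp_le_exp.2 ?_)
    gcongr
    · linarith [Real.exp_pos (y t)]
    · linarith [Real.exp_pos (x t)]
  · filter_upwards [hev] with t ht
    have hsx := Real.sigmoid_pos (x t)
    have hsy := Real.sigmoid_pos (y t)
    have hX := add_exp_step_le (R := R) (d := dsigmoid (x t) * Real.sigmoid (y t) * a t) (x t) (by
      rw [abs_mul, abs_of_pos (mul_pos (dsigmoid_pos _) hsy)]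
      exact (mul_le_of_le_one_left (abs_nonneg _)
        (mul_le_one₀ (dsigmoid_le_one _) hsy.le (Real.sigmoid_le_one _))).trans (ha t))
    have hY := add_exp_step_le (R := R) (d := dsigmoid (y t) * b t) (y t) (by
      rw [abs_mul, abs_of_pos (dsigmoid_pos _)]
      exact (mul_le_of_le_one_left (abs_nonneg _) (dsigmoid_le_one _)).trans (hbR t))
    rw [dilate_mul _ _ (mul_pos (dsigmoid_pos _) hsy).le, ← mul_assoc, ← mul_assoc,
      one_add_exp_mul_dsigmoid, ← hx] at hX
    rw [dilate_mul _ _ (dsigmoid_pos _).le, ← mul_assoc, one_add_exp_mul_dsigmoid, ← hy] at hY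
    -- The factor σ(x) extracted here gives the change of the y-part the same prefactor σ(x)σ(y) as
    -- that of the x-part, so that the drifts can be compared.
    have hb2 : dilate R (b t) ≤ Real.sigmoid (x t) * dilate R (b' t) := by
      rw [← dilate_mul _ _ hsx.le]; exact dilate_mono R (hb t)
    have hY2 := mul_le_mul_of_nonneg_left
      (hY.trans (mul_le_mul_of_nonneg_left hb2 hsy.le)) hK
    have := mul_le_mul_of_nonneg_left ht (mul_pos hsx hsy).le
    linarith

/-- A sigmoid-damped sequence decreases slowly: its sigmoid is at least of order `1 / t`. -/
theorem exists_le_sigmoid {x a : ℕ → ℝ} {R : ℝ}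
    (hx : ∀ t, x (t + 1) = x t + dsigmoid (x t) * a t) (ha : ∀ t, |a t| ≤ R) :
    ∃ c > 0, ∀ t : ℕ, c / ((t : ℝ) + 1) ≤ Real.sigmoid (x t) := by
  have hR : 0 ≤ R := (abs_nonneg _).trans (ha 0)
  have key : ∀ t : ℕ, 1 + Real.exp (-x t) ≤
      (1 + Real.exp (-x 0) + R * Real.exp R) * ((t : ℝ) + 1) := by
    intro t
    induction t with
    | zero => simp; positivity
    | succ t ih =>
      have hd : |-(dsigmoid (x t) * a t)| ≤ R := by
        rw [abs_neg, abs_mul, abs_of_pos (dsigmoid_pos _)]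
        exact (mul_le_of_le_one_left (abs_nonneg _) (dsigmoid_le_one _)).trans (ha t)
      have h1 := exp_sub_one_le_dilate hd
      have h2 : dilate R (-(dsigmoid (x t) * a t)) ≤ dsigmoid (x t) * (Real.exp R * R) := by
        rw [neg_mul_eq_mul_neg, dilate_mul _ _ (dsigmoid_pos _).le]
        refine mul_le_mul_of_nonneg_left ?_ (dsigmoid_pos _).le
        have h3 : -a t ≤ R := by have := abs_le.1 (ha t); linarith
        refine (dilate_mono R h3).trans (max_le le_rfl ?_)
        exact mul_le_mul_of_nonneg_right (Real.exp_le_exp.2 (by linarith)) hR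
      -- The damping cancels the growth of exp (-x), so 1/σ(x) = 1 + exp (-x) increases by at most R
      -- exp R per step.
      have h4 : Real.exp (-x t) * dsigmoid (x t) ≤ 1 := by
        have := one_add_exp_mul_dsigmoid (-x t)
        rw [dsigmoid_neg] at this
        have h5 := Real.sigmoid_le_one (-x t)
        have h6 := dsigmoid_pos (x t)
        nlinarith
      rw [hx, neg_add, Real.exp_add]
      have h7 := mul_le_mul_of_nonneg_left (h1.trans h2) (Real.exp_pos (-x t)).le
      have h8 := mul_le_mul_of_nonneg_right h4 (mul_nonneg (Real.exp_pos R).le hR)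
      push_cast
      nlinarith [Real.exp_pos (-x 0), Real.exp_pos (-x t)]
  refine ⟨(1 + Real.exp (-x 0) + R * Real.exp R)⁻¹, by positivity, fun t => ?_⟩
  rw [Real.sigmoid_def, ← one_div, ← one_div, div_div]
  exact one_div_le_one_div_of_le (by positivity) (key t)

/-- A sigmoid-damped sequence whose drift is eventually at least of order `1 / t` diverges. -/
theorem tendsto_atTop_of_drift {x : ℕ → ℝ} {c : ℝ} (hc : 0 < c)
    (hx : ∀ᶠ t : ℕ in atTop, x t + dsigmoid (x t) * (c / ((t : ℝ) + 1)) ≤ x (t + 1)) :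
    Tendsto x atTop atTop := by
  obtain ⟨T, hT⟩ := eventually_atTop.1 hx
  rw [← tendsto_add_atTop_iff_nat T]
  have hstep : ∀ t : ℕ, x (t + T) + dsigmoid (x (t + T)) * (c / (((t + T : ℕ) : ℝ) + 1)) ≤
      x (t + 1 + T) := fun t => by
    rw [add_right_comm]
    exact hT (t + T) (Nat.le_add_left T t)
  have hmono : Monotone fun t => x (t + T) := monotone_nat_of_le_succ fun t => by
    have := hstep t
    have h2 : 0 < dsigmoid (x (t + T)) * (c / (((t + T : ℕ) : ℝ) + 1)) :=
      mul_pos (dsigmoid_pos _) (by positivity)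
    linarith
  rcases tendsto_atTop_of_monotone hmono with h | ⟨l, h⟩
  · exact h
  exfalso
  -- At a finite limit the damping would stay bounded below, and the telescoping sum of the
  -- increments would dominate a harmonic series.
  have hd : ∀ᶠ t in atTop, dsigmoid l / 2 < dsigmoid (x (t + T)) :=
    ((continuous_dsigmoid.tendsto l).comp h).eventually
      (lt_mem_nhds (half_lt_self (dsigmoid_pos l)))
  obtain ⟨U, hU⟩ := eventually_atTop.1 hd
  have hsum : Summable fun t : ℕ => x (t + 1 + U + T) - x (t + U + T) := by
    have hle : ∀ n, ∑ t ∈ Finset.range n, (x (t + 1 + U + T) - x (t + U + T)) ≤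
        l - x (U + T) := fun n => by
      rw [Finset.sum_range_sub (fun t => x (t + U + T))]
      have := hmono.ge_of_tendsto h (n + U)
      simp only [zero_add]
      linarith
    refine summable_of_sum_range_le (fun t => sub_nonneg.2 ?_) hle
    exact hmono (by omega)
  have hharm : Summable fun t : ℕ => (dsigmoid l / 2 * c) * (1 / ((t + (U + T + 1) : ℕ) : ℝ)) := by
    refine Summable.of_nonneg_of_le (fun t => ?_) (fun t => ?_) hsum
    · have := dsigmoid_pos l
      positivity
    · have h1 := hstep (t + U)
      have h2 := hU (t + U) (Nat.le_add_left U t)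
      have h3 : t + U + 1 + T = t + 1 + U + T := by ring
      rw [h3] at h1
      have h4 : dsigmoid l / 2 * (c / (((t + U + T : ℕ) : ℝ) + 1)) ≤
          dsigmoid (x (t + U + T)) * (c / (((t + U + T : ℕ) : ℝ) + 1)) :=
        mul_le_mul_of_nonneg_right h2.le (by positivity)
      have h5 : (dsigmoid l / 2 * c) * (1 / ((t + (U + T + 1) : ℕ) : ℝ)) =
          dsigmoid l / 2 * (c / (((t + U + T : ℕ) : ℝ) + 1)) := by
        push_cast
        rw [mul_one_div, mul_div_assoc]
        congr 2
        ring
      rw [h5]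
      linarith
  rw [summable_mul_left_iff (mul_pos (half_pos (dsigmoid_pos l)) hc).ne',
    summable_nat_add_iff (f := fun t : ℕ => 1 / (t : ℝ))] at hharm
  exact Real.not_summable_one_div_natCast hharm

/-- If weights of total mass one vanish on all points where `f` may be small, then the weighted
mean of `f` is eventually above any number below the lower bound of `f` at the other points. -/
lemma eventually_lt_weighted_sum {α : Type*} (s : Finset α) (w : ℕ → α → ℝ) (f : α → ℝ)
    (good : α → Prop) (hw : ∀ t, ∀ S ∈ s, 0 ≤ w t S) (hw1 : ∀ t, ∑ S ∈ s, w t S = 1)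
    (hbad : ∀ S ∈ s, ¬ good S → Tendsto (fun t => w t S) atTop (𝓝 0)) {c c' : ℝ} (hc : c' < c)
    (hf : ∀ S ∈ s, good S → c ≤ f S) : ∀ᶠ t in atTop, c' < ∑ S ∈ s, w t S * f S := by
  classical
  have hlim : Tendsto (fun t => ∑ S ∈ s with ¬ good S, w t S * (f S - c)) atTop (𝓝 0) := by
    rw [show (0 : ℝ) = ∑ S ∈ s with ¬ good S, 0 * (f S - c) by simp]
    refine tendsto_finsetSum _ fun S hS => ?_
    rw [Finset.mem_filter] at hS
    exact (hbad S hS.1 hS.2).mul_const _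
  filter_upwards [hlim.eventually (lt_mem_nhds (show c' - c < 0 by linarith))] with t ht
  have h1 : ∑ S ∈ s, w t S * f S = c + ∑ S ∈ s, w t S * (f S - c) := by
    simp only [mul_sub, Finset.sum_sub_distrib, ← Finset.sum_mul, hw1]
    ring
  have h2 : ∑ S ∈ s with ¬ good S, w t S * (f S - c) ≤ ∑ S ∈ s, w t S * (f S - c) := by
    rw [← Finset.sum_filter_add_sum_filter_not s good]
    refine le_add_of_nonneg_left (Finset.sum_nonneg fun S hS => ?_)
    rw [Finset.mem_filter] at hS
    exact mul_nonneg (hw t S hS.1) (sub_nonneg.2 (hf S hS.1 hS.2))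
  linarith

lemma abs_weighted_sum_le {α : Type*} (s : Finset α) (w f : α → ℝ)
    (hw : ∀ S ∈ s, 0 ≤ w S) (hw1 : ∑ S ∈ s, w S = 1) :
    |∑ S ∈ s, w S * f S| ≤ ∑ S ∈ s, |f S| := by
  refine (Finset.abs_sum_le_sum_abs _ _).trans (Finset.sum_le_sum fun S hS => ?_)
  rw [abs_mul, abs_of_nonneg (hw S hS)]
  refine mul_le_of_le_one_left (abs_nonneg _) ?_
  rw [← hw1]
  exact Finset.single_le_sum hw hS

/-! ### Marginals of a causal graphical model -/

lemma updateFinset_of_dependsOn {ι : Type*} [DecidableEq ι] {Ω : ι → Type*} {β : Type*}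
    {B : Finset ι} {h : (∀ k, Ω k) → β}
    (hh : DependsOn h (↑B : Set ι)ᶜ) (x : ∀ k, Ω k) (y : ∀ i : B, Ω i) :
    h (Function.updateFinset x B y) = h x :=
  hh fun i hi => by
    have : i ∉ B := hi
    simp [Function.updateFinset, this]

section Lmarginal

variable {ι : Type*} [DecidableEq ι] {Ω : ι → Type*} [∀ i, MeasurableSpace (Ω i)]
  {μ : ∀ i, Measure (Ω i)}

lemma lmarginal_mul_of_dependsOn {B : Finset ι} {h f : (∀ k, Ω k) → ℝ≥0∞}
    (hh : DependsOn h (↑B : Set ι)ᶜ) (hf : Measurable f) (x : ∀ k, Ω k) :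
    lmarginal μ B (fun x => h x * f x) x = h x * lmarginal μ B f x := by
  unfold lmarginal
  simp only [updateFinset_of_dependsOn hh]
  exact lintegral_const_mul _ (hf.comp measurable_updateFinset)

lemma dependsOn_lmarginal (s : Finset ι) (f : (∀ k, Ω k) → ℝ≥0∞) :
    DependsOn (lmarginal μ s f) (↑s : Set ι)ᶜ :=
  fun _ _ h => lmarginal_congr μ f fun i hi => h i hi

end Lmarginal

namespace CGM

variable {ι : Type*} [Fintype ι] [DecidableEq ι] {Ω : ι → Type*} [∀ i, MeasurableSpace (Ω i)]
  {μ : ∀ i, Measure (Ω i)}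

lemma wellFounded_descendant (M : CGM Ω μ) : WellFounded fun a b => M.Ancestor b a := by
  have : IsTrans ι fun a b => M.Ancestor b a := ⟨fun _ _ _ h h' => h'.trans h⟩
  have : Std.Irrefl fun a b => M.Ancestor b a := ⟨fun a h => M.acyclic a h⟩
  exact Finite.wellFounded_of_trans_of_irrefl _

lemma measurable_mech (M : CGM Ω μ) (i : ι) : Measurable fun x => (M.mech i x : ℝ≥0∞) :=
  (M.mech_measurable i).coe_nnreal_ennreal

lemma measurable_obsDensity (M : CGM Ω μ) : Measurable M.obsDensity :=
  Finset.measurable_prod _ fun i _ => M.measurable_mech i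

/-- The nodes other than `X_j` that are not descendants of `X_j`. -/
noncomputable def nonDesc (M : CGM Ω μ) (j : ι) : Finset ι :=
  open Classical in Finset.univ.filter fun k => k ≠ j ∧ ¬ M.Ancestor j k

lemma mem_nonDesc (M : CGM Ω μ) {j k : ι} : k ∈ M.nonDesc j ↔ k ≠ j ∧ ¬ M.Ancestor j k := by
  simp [nonDesc]

lemma mem_pa (M : CGM Ω μ) {j k : ι} : k ∈ M.pa j ↔ M.Edge k j := by
  simp [pa]

lemma nonDesc_of_ancestor (M : CGM Ω μ) {i j : ι} (h : M.Ancestor i j) : i ∈ M.nonDesc j :=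
  M.mem_nonDesc.2 ⟨fun e => M.acyclic j (e ▸ h), fun h' => M.acyclic i (h.trans h')⟩

lemma ne_of_ancestor (M : CGM Ω μ) {i j : ι} (h : M.Ancestor i j) : i ≠ j :=
  (M.mem_nonDesc.1 (M.nonDesc_of_ancestor h)).1

/-- The model after the perfect intervention on `X_j`. -/
noncomputable def intervene (M : CGM Ω μ) (j : ι) : CGM Ω μ where
  Edge a b := M.Edge a b ∧ b ≠ j
  acyclic i h := M.acyclic i (Relation.TransGen.mono (fun _ _ h => h.1) _ _ h)
  mech i x := if i = j then M.interv j (x j) else M.mech i x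
  mech_measurable i := by
    by_cases h : i = j
    · simp only [h, if_true]
      exact (M.interv_measurable j).comp (measurable_pi_apply j)
    · simpa [h] using M.mech_measurable i
  mech_dependsOn i x y hxy := by
    by_cases h : i = j
    · subst h; simp [hxy i (Or.inl rfl)]
    · simp only [h, if_false]
      exact M.mech_dependsOn i fun k hk => hxy k (hk.imp id fun e => ⟨e, h⟩)
  mech_pos i x := by
    split_ifs
    exacts [M.interv_pos _ _, M.mech_pos _ _]
  mech_normalized i x := by
    by_cases h : i = j
    · subst h; simpa using M.interv_normalized i
    · simpa [h] using M.mech_normalized i x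
  interv := M.interv
  interv_measurable := M.interv_measurable
  interv_pos := M.interv_pos
  interv_normalized := M.interv_normalized

/-- Interventional laws are observational laws of the mutilated model, so every fact on marginals
applies to them. -/
lemma obsDensity_intervene (M : CGM Ω μ) (j : ι) : (M.intervene j).obsDensity = M.intDensity j := by
  funext x
  rw [obsDensity, intDensity, ← Finset.mul_prod_erase _ _ (Finset.mem_univ j)]
  congr 1
  · simp [intervene]
  · exact Finset.prod_congr rfl fun i hi => by simp [intervene, Finset.ne_of_mem_erase hi]

lemma nonempty_pi (M : CGM Ω μ) : Nonempty (∀ k, Ω k) := by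
  rw [← not_isEmpty_iff, isEmpty_pi]
  rintro ⟨k, hk⟩
  simpa using M.interv_normalized k

lemma measure_ne_zero (M : CGM Ω μ) (i : ι) : μ i ≠ 0 := fun h => by
  simpa [h] using M.interv_normalized i

lemma dependsOn_margDensity (M : CGM Ω μ) (S : Finset ι) : DependsOn (M.margDensity S) ↑S := by
  have := dependsOn_lmarginal (μ := μ) Sᶜ M.obsDensity
  rw [Finset.coe_compl, compl_compl] at this
  exact this

lemma nonDesc_ancestral (M : CGM Ω μ) (j : ι) :
    ∀ k ∈ M.nonDesc j, ∀ l, M.Edge l k → l ∈ M.nonDesc j := fun k hk l hl => by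
  rw [mem_nonDesc] at hk ⊢
  refine ⟨?_, fun h => hk.2 (h.tail hl)⟩
  rintro rfl
  exact hk.2 (Relation.TransGen.single hl)

lemma obsDensity_ne_zero (M : CGM Ω μ) (x : ∀ k, Ω k) : M.obsDensity x ≠ 0 :=
  Finset.prod_ne_zero_iff.2 fun i _ => by simpa using (M.mech_pos i x).ne'

lemma measurable_intDensity (M : CGM Ω μ) (j : ι) : Measurable (M.intDensity j) := by
  rw [← obsDensity_intervene]; exact measurable_obsDensity _

lemma intMeasure_absolutelyContinuous (M : CGM Ω μ) (j : ι) : M.intMeasure j ≪ Measure.pi μ :=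
  withDensity_absolutelyContinuous _ _

/-- Positivity of the densities is what carries an equality seen under an intervention back to the
reference measure. -/
lemma absolutelyContinuous_intMeasure (M : CGM Ω μ) (j : ι) : Measure.pi μ ≪ M.intMeasure j :=
  withDensity_absolutelyContinuous' (M.measurable_intDensity j).aemeasurable
    (.of_forall fun x => by rw [← obsDensity_intervene]; exact obsDensity_ne_zero _ x)

/-- The gain vanishes almost everywhere for the reference measure, hence under all interventions at
once. -/
lemma CondIndep.expGain_eq_zero {M : CGM Ω μ} {i j : ι} {S : Finset ι} (h : M.CondIndep i j S)
    (k : ι) : M.expGain k i j S = 0 :=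
  integral_eq_zero_of_ae ((M.intMeasure_absolutelyContinuous k).ae_le h)

variable [∀ i, SigmaFinite (μ i)]

lemma measurable_margDensity (M : CGM Ω μ) (S : Finset ι) : Measurable (M.margDensity S) :=
  M.measurable_obsDensity.lmarginal μ

/-- Integrating out the variables in `B` from a function that depends on them only through their
own mechanisms removes these mechanisms. -/
lemma lmarginal_mul_prod_mech (M : CGM Ω μ) (B : Finset ι) {h : (∀ k, Ω k) → ℝ≥0∞}
    (hm : Measurable h) (hh : DependsOn h (↑B : Set ι)ᶜ) :
    lmarginal μ B (fun x => h x * ∏ k ∈ B, (M.mech k x : ℝ≥0∞)) = h := by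
  induction B using Finset.strongInduction with
  | H B ih =>
  rcases B.eq_empty_or_nonempty with rfl | hB
  · simp
  -- A variable of `B` without descendants in `B` is integrated out first: among the mechanisms in
  -- the product only its own reads it, and that one integrates to 1.
  obtain ⟨k, hk, hmin⟩ := M.wellFounded_descendant.has_min (↑B : Set ι) hB
  have hk' : k ∈ B := hk
  have hmeas : Measurable fun x => h x * ∏ k ∈ B, (M.mech k x : ℝ≥0∞) :=
    hm.mul (Finset.measurable_prod _ fun i _ => M.measurable_mech i)
  rw [lmarginal_erase' _ hmeas hk']
  have hin : (fun x => ∫⁻ t, (h (Function.update x k t) *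
      ∏ l ∈ B, (M.mech l (Function.update x k t) : ℝ≥0∞)) ∂μ k) =
      fun x => h x * ∏ l ∈ B.erase k, (M.mech l x : ℝ≥0∞) := by
    funext x
    have h1 : ∀ t, h (Function.update x k t) *
        ∏ l ∈ B, (M.mech l (Function.update x k t) : ℝ≥0∞) =
        (h x * ∏ l ∈ B.erase k, (M.mech l x : ℝ≥0∞)) *
          (M.mech k (Function.update x k t) : ℝ≥0∞) := fun t => by
      rw [← Finset.prod_erase_mul _ _ hk', ← mul_assoc]
      congr 2
      · refine hh fun l hl => Function.update_of_ne ?_ _ _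
        rintro rfl
        exact hl hk
      · refine Finset.prod_congr rfl fun l hl => ?_
        congr 1
        refine M.mech_dependsOn l fun m hm => Function.update_of_ne ?_ _ _
        rintro rfl
        rcases hm with rfl | hm
        · exact Finset.notMem_erase _ _ hl
        · exact hmin l (Finset.mem_of_mem_erase hl) (Relation.TransGen.single hm)
    simp_rw [h1]
    rw [lintegral_const_mul _ (by
      exact (M.measurable_mech k).comp (measurable_update x)), M.mech_normalized, mul_one]
  rw [hin]
  refine ih _ (Finset.erase_ssubset hk') (hh.mono ?_)
  simp

/-- The marginal density of an ancestral set is the product of its mechanisms. -/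
lemma margDensity_of_ancestral (M : CGM Ω μ) {A : Finset ι}
    (hA : ∀ k ∈ A, ∀ l, M.Edge l k → l ∈ A) :
    M.margDensity A = fun x => ∏ k ∈ A, (M.mech k x : ℝ≥0∞) := by
  have h := M.lmarginal_mul_prod_mech Aᶜ (h := fun x => ∏ k ∈ A, (M.mech k x : ℝ≥0∞))
    (Finset.measurable_prod _ fun i _ => M.measurable_mech i) (fun x y hxy => by
      refine Finset.prod_congr rfl fun k hk => ?_
      congr 1
      refine M.mech_dependsOn k fun l hl => hxy l ?_
      rcases hl with rfl | hl
      · simpa using hk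
      · simpa using hA k hk l hl)
  simp only [Finset.prod_mul_prod_compl] at h
  exact h

lemma margDensity_of_subset (M : CGM Ω μ) {S T : Finset ι} (h : S ⊆ T) :
    M.margDensity S = lmarginal μ (T \ S) (M.margDensity T) := by
  have hU : Sᶜ = (T \ S) ∪ Tᶜ := by
    ext k
    simp only [Finset.mem_compl, Finset.mem_union, Finset.mem_sdiff]
    have := @h k
    tauto
  have hd : Disjoint (T \ S) Tᶜ :=
    disjoint_compl_right.mono_left Finset.sdiff_subset
  have := lmarginal_union μ M.obsDensity M.measurable_obsDensity hd
  rw [← hU] at this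
  exact this

lemma lmarginal_margDensity (M : CGM Ω μ) (S : Finset ι) (x : ∀ k, Ω k) :
    lmarginal μ S (M.margDensity S) x = 1 := by
  have h := M.margDensity_of_subset (Finset.empty_subset S)
  rw [Finset.sdiff_empty] at h
  rw [← h, M.margDensity_of_ancestral (by simp)]
  simp

/-- The Markov property: given non-descendants including all parents, the conditional density of
`X_j` is its mechanism. -/
lemma margDensity_insert (M : CGM Ω μ) {j : ι} {T : Finset ι} (hpa : M.pa j ⊆ T)
    (hT : T ⊆ M.nonDesc j) (x : ∀ k, Ω k) :
    M.margDensity (insert j T) x = M.mech j x * M.margDensity T x := by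
  have hj : j ∉ M.nonDesc j := fun h => (M.mem_nonDesc.1 h).1 rfl
  -- The non-descendants form an ancestral set with or without `j`, so the two marginals differ by
  -- the mechanism of `j`. This factor survives integrating out the variables outside `T`, since it
  -- does not read them.
  have hA := M.margDensity_of_ancestral (M.nonDesc_ancestral j)
  have hA' : M.margDensity (insert j (M.nonDesc j)) =
      fun x => (M.mech j x : ℝ≥0∞) * M.margDensity (M.nonDesc j) x := by
    rw [M.margDensity_of_ancestral, hA]
    · funext x
      rw [Finset.prod_insert hj]
    · intro k hk l hl
      rcases Finset.mem_insert.1 hk with rfl | hk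
      · exact Finset.mem_insert_of_mem (hT (hpa (M.mem_pa.2 hl)))
      · exact Finset.mem_insert_of_mem (M.nonDesc_ancestral j k hk l hl)
  have hs : insert j (M.nonDesc j) \ insert j T = M.nonDesc j \ T := by
    ext k
    simp only [Finset.mem_sdiff, Finset.mem_insert]
    have : k = j → k ∉ M.nonDesc j := fun e => e ▸ hj
    tauto
  rw [M.margDensity_of_subset (Finset.insert_subset_insert j hT), hs, hA',
    M.margDensity_of_subset hT]
  refine lmarginal_mul_of_dependsOn (fun x y hxy => ?_) (M.measurable_margDensity _) x
  congr 1
  refine M.mech_dependsOn j fun l hl => hxy l ?_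
  rcases hl with rfl | hl
  · simpa using fun h => absurd h hj
  · simpa using fun _ => hpa (M.mem_pa.2 hl)

/-- Intervening on `X_j` does not change the law of its non-descendants, of which `X_j` becomes
independent. -/
lemma margDensity_intervene_insert (M : CGM Ω μ) {j : ι} {T : Finset ι} (hT : T ⊆ M.nonDesc j)
    (x : ∀ k, Ω k) :
    (M.intervene j).margDensity (insert j T) x = M.interv j (x j) * M.margDensity T x := by
  have hN : M.nonDesc j ⊆ (M.intervene j).nonDesc j := fun k hk => by
    rw [mem_nonDesc] at hk ⊢
    exact ⟨hk.1, fun h => hk.2 (Relation.TransGen.mono (fun _ _ h => h.1) _ _ h)⟩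
  rw [margDensity_insert _ _ (hT.trans hN)]
  · congr 1
    · simp [intervene]
    · rw [margDensity_of_subset _ hT, margDensity_of_subset _ hT,
        M.margDensity_of_ancestral (M.nonDesc_ancestral j), margDensity_of_ancestral]
      · congr 1
        funext x
        refine Finset.prod_congr rfl fun k hk => ?_
        simp [intervene, (M.mem_nonDesc.1 hk).1]
      · exact fun k hk l hl => M.nonDesc_ancestral j k hk l hl.1
  · intro k hk
    exact absurd rfl ((M.intervene j).mem_pa.1 hk).2

lemma margDensity_ne_zero (M : CGM Ω μ) (S : Finset ι) (x : ∀ k, Ω k) :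
    M.margDensity S x ≠ 0 := by
  unfold margDensity lmarginal
  rw [Ne, lintegral_eq_zero_iff (by exact M.measurable_obsDensity.comp measurable_updateFinset)]
  intro h
  have h1 : Measure.pi (fun i : (Sᶜ : Finset ι) => μ i) Set.univ = 0 := by
    refine measure_mono_null (fun y _ => ?_) (ae_iff.1 h)
    exact M.obsDensity_ne_zero _
  rw [Measure.pi_univ, Finset.prod_eq_zero_iff] at h1
  obtain ⟨i, -, hi⟩ := h1
  exact M.measure_ne_zero i (Measure.measure_univ_eq_zero.1 hi)

lemma margDensity_ae_ne_top (M : CGM Ω μ) (S : Finset ι) :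
    ∀ᵐ x ∂(Measure.pi μ), M.margDensity S x ≠ ∞ := by
  set E : Set (∀ k, Ω k) := {x | M.margDensity S x = ∞} with hE
  have hEm : MeasurableSet E := M.measurable_margDensity S (measurableSet_singleton ∞)
  have hEi : Measurable (E.indicator fun _ => (1 : ℝ≥0∞)) := measurable_const.indicator hEm
  have h0 : ∀ x, lmarginal μ S (E.indicator fun _ => 1) x = 0 := fun x => by
    -- On `E` the marginal density is infinite, yet it integrates to 1 over the variables in `S`;
    -- hence the slices of `E` are null.
    have h1 : ∞ * lmarginal μ S (E.indicator fun _ => 1) x ≤ 1 := by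
      refine le_of_le_of_eq ?_ (M.lmarginal_margDensity S x)
      rw [← lmarginal_mul_of_dependsOn (h := fun _ => ∞) (fun _ _ _ => rfl) hEi]
      refine lmarginal_mono (fun y => ?_) x
      by_cases hy : y ∈ E
      · simp [Set.indicator_of_mem hy, show M.margDensity S y = ∞ from hy]
      · simp [Set.indicator_of_notMem hy]
    by_contra h2
    rw [ENNReal.top_mul h2] at h1
    exact absurd h1 (by simp)
  rw [ae_iff]
  simp only [not_not]
  rw [← hE, ← lintegral_indicator_one hEm]
  obtain ⟨x₀⟩ := M.nonempty_pi
  have hd : Disjoint Sᶜ S := disjoint_compl_left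
  have hU := lmarginal_union μ _ hEi hd
  rw [Finset.union_comm, Finset.union_compl] at hU
  change ∫⁻ x, (E.indicator (fun _ => (1 : ℝ≥0∞))) x ∂_ = 0
  rw [lintegral_eq_lmarginal_univ x₀, hU, show lmarginal μ S (E.indicator fun _ => 1) =
    fun _ => 0 from funext h0]
  simp [lmarginal]

lemma isProbabilityMeasure_intMeasure (M : CGM Ω μ) (j : ι) :
    IsProbabilityMeasure (M.intMeasure j) := by
  obtain ⟨x₀⟩ := M.nonempty_pi
  refine ⟨?_⟩
  rw [intMeasure, withDensity_apply _ MeasurableSet.univ, Measure.restrict_univ,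
    lintegral_eq_lmarginal_univ x₀, ← obsDensity_intervene]
  simpa [margDensity] using (M.intervene j).lmarginal_margDensity Finset.univ x₀

/-- The likelihood ratio `p(x_i | x_S, x_j) / p(x_i | x_S)`. -/
noncomputable def likRatio (M : CGM Ω μ) (i j : ι) (S : Finset ι) (x : ∀ k, Ω k) : ℝ≥0∞ :=
  M.margDensity (insert i (insert j S)) x / M.margDensity (insert j S) x *
    (M.margDensity S x / M.margDensity (insert i S) x)

lemma measurable_likRatio (M : CGM Ω μ) (i j : ι) (S : Finset ι) :
    Measurable (M.likRatio i j S) :=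
  ((M.measurable_margDensity _).div (M.measurable_margDensity _)).mul
    ((M.measurable_margDensity _).div (M.measurable_margDensity _))

lemma likRatio_ae (M : CGM Ω μ) (i j : ι) (S : Finset ι) :
    ∀ᵐ x ∂(Measure.pi μ), M.likRatio i j S x ≠ 0 ∧ M.likRatio i j S x ≠ ∞ ∧
      M.llGain j i S x = Real.log (M.likRatio i j S x).toReal ∧
      M.llGain i j S x = Real.log (M.likRatio i j S x).toReal := by
  filter_upwards [M.margDensity_ae_ne_top (insert i (insert j S)),
    M.margDensity_ae_ne_top (insert j S), M.margDensity_ae_ne_top (insert i S),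
    M.margDensity_ae_ne_top S] with x h1 h2 h3 h4
  have g1 := M.margDensity_ne_zero (insert i (insert j S)) x
  have g2 := M.margDensity_ne_zero (insert j S) x
  have g3 := M.margDensity_ne_zero (insert i S) x
  have g4 := M.margDensity_ne_zero S x
  have r1 := (ENNReal.toReal_pos g1 h1).ne'
  have r2 := (ENNReal.toReal_pos g2 h2).ne'
  have r3 := (ENNReal.toReal_pos g3 h3).ne'
  have r4 := (ENNReal.toReal_pos g4 h4).ne'
  refine ⟨mul_ne_zero (ENNReal.div_ne_zero.2 ⟨g1, h2⟩) (ENNReal.div_ne_zero.2 ⟨g4, h3⟩),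
    ENNReal.mul_ne_top (ENNReal.div_ne_top h1 g2) (ENNReal.div_ne_top h4 g3), ?_, ?_⟩
  · simp only [llGain, logLik, likRatio, ENNReal.toReal_mul, ENNReal.toReal_div]
    rw [Real.log_mul (div_ne_zero r1 r2) (div_ne_zero r4 r3), Real.log_div r1 r2,
      Real.log_div r4 r3, Real.log_div r3 r4]
    ring
  · simp only [llGain, logLik, likRatio, ENNReal.toReal_mul, ENNReal.toReal_div]
    rw [Finset.insert_comm j i, Real.log_mul (div_ne_zero r1 r2) (div_ne_zero r4 r3),
      Real.log_div r1 r2, Real.log_div r4 r3, Real.log_div r1 r3, Real.log_div r2 r4]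
    ring

/-- Both gains are the pointwise conditional mutual information log (p(x_i, x_j, x_S) p(x_S) /
(p(x_i, x_S) p(x_j, x_S))). -/
lemma llGain_comm_ae (M : CGM Ω μ) (i j : ι) (S : Finset ι) :
    M.llGain i j S =ᵐ[Measure.pi μ] M.llGain j i S := by
  filter_upwards [M.likRatio_ae i j S] with x hx
  rw [hx.2.2.1, hx.2.2.2]

lemma CondIndep.symm {M : CGM Ω μ} {i j : ι} {S : Finset ι} (h : M.CondIndep i j S) :
    M.CondIndep j i S := by
  filter_upwards [h, M.llGain_comm_ae i j S] with x hx hx'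
  rw [← hx', hx]

/-- Given a set of non-descendants including its parents, a variable is independent of its other
non-descendants. -/
lemma condIndep_of_pa_subset (M : CGM Ω μ) {i j : ι} {S : Finset ι} (hpa : M.pa j ⊆ S)
    (hS : S ⊆ M.nonDesc j) (hi : i ∈ M.nonDesc j) : M.CondIndep i j S := by
  filter_upwards [M.margDensity_ae_ne_top (insert i S), M.margDensity_ae_ne_top S] with x h1 h2
  rw [llGain, logLik, logLik, M.margDensity_insert hpa hS,
    M.margDensity_insert (hpa.trans (Finset.subset_insert i S))
      (Finset.insert_subset hi hS), ENNReal.mul_div_cancel_right (M.margDensity_ne_zero _ x) h1,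
    ENNReal.mul_div_cancel_right (M.margDensity_ne_zero _ x) h2, sub_self]

/-- On the variables involved the intervened law has density q_j(x_j) p(x_i, x_S), which the ratio
turns into q_j(x_j) p(x_S) p(x_i | x_S, x_j). Integrating out x_i leaves q_j(x_j) p(x_S), of mass 1.
Working with ≤ avoids treating points with infinite marginals separately, as a * (b / a) ≤ b always
holds. -/
lemma lintegral_likRatio_le_one (M : CGM Ω μ) {i j : ι} {S : Finset ι} (hij : i ≠ j)
    (hiS : i ∉ S) (hS : insert i S ⊆ M.nonDesc j) :
    ∫⁻ x, M.likRatio i j S x ∂(M.intMeasure j) ≤ 1 := by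
  obtain ⟨x₀⟩ := M.nonempty_pi
  have hr := M.measurable_likRatio i j S
  have hT : insert i (insert j S) = insert j (insert i S) := Finset.insert_comm i j S
  set T := insert i (insert j S) with hTdef
  have hrT : DependsOn (M.likRatio i j S) (↑T : Set ι) := fun x y hxy => by
    have hsub : ∀ {A : Finset ι}, A ⊆ T → M.margDensity A x = M.margDensity A y := fun hA =>
      M.dependsOn_margDensity _ fun k hk => hxy k (hA hk)
    unfold likRatio
    rw [hsub Finset.Subset.rfl, hsub (Finset.subset_insert _ _),
      hsub ((Finset.subset_insert j S).trans (Finset.subset_insert _ _)),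
      hsub (Finset.insert_subset_insert i (Finset.subset_insert j S))]
  have hstep1 : lmarginal μ Tᶜ (fun x => M.likRatio i j S x * (M.intervene j).obsDensity x) =
      fun x => M.likRatio i j S x * (M.intervene j).margDensity T x := by
    funext x
    exact lmarginal_mul_of_dependsOn (by simpa using hrT) (measurable_obsDensity _) x
  have hle : (fun x => M.likRatio i j S x * (M.intervene j).margDensity T x) ≤
      fun x => (M.interv j (x j) * (M.margDensity S x / M.margDensity (insert j S) x)) *
        M.margDensity T x := fun x => by
    dsimp only
    rw [hT, M.margDensity_intervene_insert hS, ← hT]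
    unfold likRatio
    calc _ = M.interv j (x j) * (M.margDensity T x / M.margDensity (insert j S) x) *
          (M.margDensity (insert i S) x * (M.margDensity S x / M.margDensity (insert i S) x)) := by
          ring
      _ ≤ M.interv j (x j) * (M.margDensity T x / M.margDensity (insert j S) x) *
          M.margDensity S x := by gcongr; exact ENNReal.mul_div_le
      _ = _ := by simp only [div_eq_mul_inv]; ring
  have hTi : T \ insert j S = {i} := by
    rw [hTdef, Finset.insert_sdiff_of_notMem, Finset.sdiff_self]
    · rfl
    · simp [hij, hiS]
  have hmT := M.measurable_margDensity T
  have hstep2 : lmarginal μ {i} (fun x =>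
      (M.interv j (x j) * (M.margDensity S x / M.margDensity (insert j S) x)) *
        M.margDensity T x) ≤ (M.intervene j).margDensity (insert j S) := fun x => by
    rw [lmarginal_mul_of_dependsOn _ hmT, ← hTi,
      ← M.margDensity_of_subset (Finset.subset_insert _ _),
      M.margDensity_intervene_insert ((Finset.subset_insert i S).trans hS), mul_assoc]
    · gcongr
      rw [mul_comm]
      exact ENNReal.mul_div_le
    · intro y z hyz
      have hj : y j = z j := hyz j (by simpa using hij.symm)
      have hsub : ∀ {A : Finset ι}, i ∉ A → M.margDensity A y = M.margDensity A z := fun hA =>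
        M.dependsOn_margDensity _ fun k hk => hyz k (by
          simp only [Finset.coe_singleton, Set.mem_compl_iff, Set.mem_singleton_iff]
          rintro rfl
          exact hA hk)
      dsimp only
      rw [hj, hsub hiS, hsub (by simp [hij, hiS])]
  have hdisj1 : Disjoint T Tᶜ := disjoint_compl_right
  have hdisj2 : Disjoint (insert j S) ({i} : Finset ι) := by simp [hij, hiS]
  have hU : insert j S ∪ {i} = T := by rw [Finset.union_comm]; rfl
  have hm1 : Measurable fun x => M.likRatio i j S x * (M.intervene j).obsDensity x :=
    hr.mul (measurable_obsDensity _)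
  have hq : Measurable fun x : (∀ k, Ω k) => (M.interv j (x j) : ℝ≥0∞) :=
    ((M.interv_measurable j).comp (measurable_pi_apply j)).coe_nnreal_ennreal
  have hm2 : Measurable fun x =>
      (M.interv j (x j) * (M.margDensity S x / M.margDensity (insert j S) x)) *
        M.margDensity T x :=
    (hq.mul ((M.measurable_margDensity _).div (M.measurable_margDensity _))).mul hmT
  have hu1 := lmarginal_union μ _ hm1 hdisj1
  have hu2 := lmarginal_union μ _ hm2 hdisj2
  rw [Finset.union_compl] at hu1
  rw [hU] at hu2
  rw [intMeasure, lintegral_withDensity_eq_lintegral_mul _ (M.measurable_intDensity j) hr,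
    ← obsDensity_intervene, mul_comm, lintegral_eq_lmarginal_univ x₀]
  change lmarginal μ Finset.univ
    (fun x => M.likRatio i j S x * (M.intervene j).obsDensity x) x₀ ≤ 1
  rw [hu1, hstep1]
  refine (lmarginal_mono hle x₀).trans ?_
  rw [hu2, ← (M.intervene j).lmarginal_margDensity (insert j S) x₀]
  exact lmarginal_mono hstep2 x₀

/-- Under the intervention on `X_j`, adding `X_j` to a set of non-descendants of `X_j` as
predictors of another non-descendant never raises the expected log-likelihood, and keeps it only
in the case of conditional independence. -/
theorem expGain_anticausal (M : CGM Ω μ) (hfin : M.FiniteGains) {i j : ι} {S : Finset ι}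
    (hij : i ≠ j) (hiS : i ∉ S) (hS : insert i S ⊆ M.nonDesc j) :
    M.expGain j j i S < 0 ∨ M.CondIndep j i S := by
  have := M.isProbabilityMeasure_intMeasure j
  have hjS : j ∉ S := fun h =>
    (M.mem_nonDesc.1 (hS (Finset.mem_insert_of_mem h))).1 rfl
  have hint := hfin j i j S hij.symm hij.symm hjS hiS
  have hae : ∀ᵐ x ∂(M.intMeasure j), _ :=
    (M.intMeasure_absolutelyContinuous j).ae_le (M.likRatio_ae i j S)
  have hle := M.lintegral_likRatio_le_one hij hiS hS
  have hrint : Integrable (fun x => (M.likRatio i j S x).toReal) (M.intMeasure j) :=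
    integrable_toReal_of_lintegral_ne_top (M.measurable_likRatio i j S).aemeasurable
      (hle.trans_lt ENNReal.one_lt_top).ne
  have hr1 : ∫ x, (M.likRatio i j S x).toReal ∂(M.intMeasure j) ≤ 1 := by
    rw [integral_toReal (M.measurable_likRatio i j S).aemeasurable
      (hae.mono fun x hx => lt_top_iff_ne_top.2 hx.2.1)]
    exact ENNReal.toReal_le_of_le_ofReal zero_le_one (by simpa using hle)
  rcases lt_or_ge (M.expGain j j i S) 0 with h | h
  · exact Or.inl h
  right
  have hnn : 0 ≤ᵐ[M.intMeasure j]
      fun x => (M.likRatio i j S x).toReal - 1 - M.llGain j i S x := by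
    filter_upwards [hae] with x hx
    have := Real.log_le_sub_one_of_pos (ENNReal.toReal_pos hx.1 hx.2.1)
    simp only [Pi.zero_apply]
    rw [hx.2.2.1]
    linarith
  -- If the gain is not negative, log r ≤ r - 1 must be an equality almost everywhere, which forces
  -- r = 1.
  have hi0 : ∫ x, ((M.likRatio i j S x).toReal - 1 - M.llGain j i S x) ∂(M.intMeasure j) = 0 := by
    refine le_antisymm ?_ (integral_nonneg_of_ae hnn)
    rw [integral_sub (by exact hrint.sub (integrable_const 1)) hint,
      integral_sub hrint (integrable_const 1)]
    simp only [integral_const, probReal_univ, smul_eq_mul, mul_one]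
    unfold expGain at h
    linarith
  rw [integral_eq_zero_iff_of_nonneg_ae hnn ((hrint.sub (integrable_const 1)).sub hint)] at hi0
  refine (M.absolutelyContinuous_intMeasure j).ae_le ?_
  filter_upwards [hi0, hae] with x h0 hx
  have hpos := ENNReal.toReal_pos hx.1 hx.2.1
  simp only [Pi.zero_apply] at h0
  rw [hx.2.2.1] at h0 ⊢
  have h1 : (M.likRatio i j S x).toReal = 1 := by
    by_contra hne
    linarith [Real.log_lt_sub_one_of_pos hpos hne]
  rw [h1, Real.log_one]

end CGM

/-! ### Sampled parent sets -/

lemma exists_pos_le_of_forall_pos {α : Type*} (s : Finset α) (P : α → Prop) (f : α → ℝ)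
    (h : ∀ S ∈ s, P S → 0 < f S) : ∃ c > 0, ∀ S ∈ s, P S → c ≤ f S := by
  classical
  rcases (s.filter P).eq_empty_or_nonempty with he | hne
  · refine ⟨1, one_pos, fun S hS hP => absurd (Finset.mem_filter.2 ⟨hS, hP⟩) ?_⟩
    simp [he]
  · obtain ⟨S₀, hS₀, hmin⟩ := Finset.exists_min_image _ f hne
    rw [Finset.mem_filter] at hS₀
    exact ⟨f S₀, h _ hS₀.1 hS₀.2, fun S hS hP => hmin S (Finset.mem_filter.2 ⟨hS, hP⟩)⟩

section Parents

variable {ι : Type*}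

lemma edgeProb_pos (γ θ : ι → ι → ℝ) (i j : ι) : 0 < edgeProb γ θ i j :=
  mul_pos (Real.sigmoid_pos _) (Real.sigmoid_pos _)

lemma edgeProb_le_one (γ θ : ι → ι → ℝ) (i j : ι) : edgeProb γ θ i j ≤ 1 :=
  mul_le_one₀ (Real.sigmoid_le_one _) (Real.sigmoid_nonneg _) (Real.sigmoid_le_one _)

variable [Fintype ι] [DecidableEq ι]

lemma parentProb_nonneg (γ θ : ι → ι → ℝ) (i j : ι) (S : Finset ι) :
    0 ≤ parentProb γ θ i j S :=
  mul_nonneg (Finset.prod_nonneg fun _ _ => (edgeProb_pos _ _ _ _).le)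
    (Finset.prod_nonneg fun _ _ => sub_nonneg.2 (edgeProb_le_one _ _ _ _))

lemma sum_parentProb (γ θ : ι → ι → ℝ) (i j : ι) :
    ∑ S ∈ (Finset.univ \ {i, j}).powerset, parentProb γ θ i j S = 1 := by
  unfold parentProb
  rw [← Finset.prod_add]
  simp

lemma parentProb_le_of_mem (γ θ : ι → ι → ℝ) (i : ι) {j k : ι} {S : Finset ι} (hk : k ∈ S) :
    parentProb γ θ i j S ≤ edgeProb γ θ k j := by
  unfold parentProb
  rw [← Finset.mul_prod_erase _ _ hk, mul_assoc]
  refine mul_le_of_le_one_right (edgeProb_pos _ _ _ _).le (mul_le_one₀ ?_ ?_ ?_)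
  · exact Finset.prod_le_one (fun _ _ => (edgeProb_pos _ _ _ _).le)
      fun _ _ => edgeProb_le_one _ _ _ _
  · exact Finset.prod_nonneg fun _ _ => sub_nonneg.2 (edgeProb_le_one _ _ _ _)
  · exact Finset.prod_le_one (fun _ _ => sub_nonneg.2 (edgeProb_le_one _ _ _ _))
      fun _ _ => sub_le_self _ (edgeProb_pos _ _ _ _).le

lemma parentProb_le_of_notMem (γ θ : ι → ι → ℝ) {i j k : ι} {S : Finset ι} (hk : k ∉ S)
    (hki : k ≠ i) (hkj : k ≠ j) : parentProb γ θ i j S ≤ 1 - edgeProb γ θ k j := by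
  unfold parentProb
  have hk' : k ∈ (Finset.univ \ {i, j}) \ S := by simp [hk, hki, hkj]
  rw [← Finset.mul_prod_erase _ _ hk', mul_left_comm]
  refine mul_le_of_le_one_right (sub_nonneg.2 (edgeProb_le_one _ _ _ _)) (mul_le_one₀ ?_ ?_ ?_)
  · exact Finset.prod_le_one (fun _ _ => (edgeProb_pos _ _ _ _).le)
      fun _ _ => edgeProb_le_one _ _ _ _
  · exact Finset.prod_nonneg fun _ _ => sub_nonneg.2 (edgeProb_le_one _ _ _ _)
  · exact Finset.prod_le_one (fun _ _ => sub_nonneg.2 (edgeProb_le_one _ _ _ _))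
      fun _ _ => sub_le_self _ (edgeProb_pos _ _ _ _).le

variable {γ θ : ℕ → ι → ι → ℝ}

lemma parentProb_tendsto_zero_of_mem (i : ι) {j k : ι} {S : Finset ι} (hk : k ∈ S)
    (h : Tendsto (fun t => edgeProb (γ t) (θ t) k j) atTop (𝓝 0)) :
    Tendsto (fun t => parentProb (γ t) (θ t) i j S) atTop (𝓝 0) :=
  squeeze_zero (fun _ => parentProb_nonneg _ _ _ _ _)
    (fun _ => parentProb_le_of_mem _ _ i hk) h

lemma parentProb_tendsto_zero_of_notMem {i j k : ι} {S : Finset ι} (hk : k ∉ S)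
    (hki : k ≠ i) (hkj : k ≠ j)
    (h : Tendsto (fun t => edgeProb (γ t) (θ t) k j) atTop (𝓝 1)) :
    Tendsto (fun t => parentProb (γ t) (θ t) i j S) atTop (𝓝 0) :=
  squeeze_zero (fun _ => parentProb_nonneg _ _ _ _ _)
    (fun _ => parentProb_le_of_notMem _ _ hk hki hkj)
    (by simpa using (tendsto_const_nhds (x := (1 : ℝ))).sub h)

end Parents

/-! ### Conditions on the model -/

lemma acyclic_insert_edge {ι : Type*} {G : ι → ι → Prop} (hG : Acyclic G) {k j : ι}
    (h : ¬ Relation.ReflTransGen G j k) : Acyclic fun a b => G a b ∨ (a = k ∧ b = j) := by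
  -- A path using the new edge is cut at its first and last use; for a cycle, the two pieces join to
  -- a path from `j` to `k`.
  have key : ∀ {a b}, Relation.TransGen (fun a b => G a b ∨ (a = k ∧ b = j)) a b →
      Relation.TransGen G a b ∨
        (Relation.ReflTransGen G a k ∧ Relation.ReflTransGen G j b) := by
    intro a b hab
    induction hab with
    | single hb =>
      rcases hb with hb | ⟨rfl, rfl⟩
      · exact Or.inl (.single hb)
      · exact Or.inr ⟨.refl, .refl⟩
    | tail _ hb ih =>
      rcases hb with hb | ⟨rfl, rfl⟩
      · exact ih.imp (fun h => h.tail hb) fun h => ⟨h.1, h.2.tail hb⟩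
      · exact Or.inr ⟨ih.elim (fun h => h.to_reflTransGen) fun h => h.1, .refl⟩
  intro i hi
  rcases key hi with h' | ⟨h1, h2⟩
  · exact hG i h'
  · exact h (h2.trans h1)

section Model

variable {ι : Type*} [Fintype ι] [DecidableEq ι] {Ω : ι → Type*} [∀ i, MeasurableSpace (Ω i)]
  {μ : ∀ i, Measure (Ω i)}

/-- This makes Condition 3 available for all parent sets that survive asymptotically. -/
lemma CGM.subset_gpa (M : CGM Ω μ) {i j : ι} {S : Finset ι} (hi : i ∉ S)
    (hS : S ⊆ M.nonDesc j) : (S : Set ι) ⊆ M.gpa i j := by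
  intro k hk
  have hk' := M.mem_nonDesc.1 (hS hk)
  refine ⟨fun e => hi (e ▸ hk), acyclic_insert_edge M.acyclic fun h => ?_⟩
  rcases Relation.reflTransGen_iff_eq_or_transGen.1 h with h | h
  exacts [hk'.1 h, hk'.2 h]

/-- The gain of `γ_ij` from the parent set `S`, net of the sparsity penalty. -/
noncomputable def netGain (M : CGM Ω μ) (p : ι → ℝ) (lam : ℝ) (i j : ι) (S : Finset ι) : ℝ :=
  ∑ k ∈ Finset.univ.erase j, p k * (M.expGain k i j S - lam)

lemma sum_erase_pos {p : ι → ℝ} (hp : ∀ i, 0 < p i) {i j : ι} (hij : i ≠ j) :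
    0 < ∑ k ∈ Finset.univ.erase j, p k :=
  Finset.sum_pos (fun k _ => hp k) ⟨i, by simp [hij]⟩

lemma Condition3.netGain_pos {M : CGM Ω μ} {p : ι → ℝ} {lam : ℝ} {i j : ι}
    (h : Condition3 M p lam i j) (hp : ∀ i, 0 < p i) (hij : i ≠ j) {S : Finset ι} (hi : i ∉ S)
    (hS : S ⊆ M.nonDesc j) : 0 < netGain M p lam i j S := by
  have h1 := h S (M.subset_gpa hi hS)
  rw [lt_div_iff₀ (sum_erase_pos hp hij)] at h1
  simp only [netGain, mul_sub, Finset.sum_sub_distrib, ← Finset.sum_mul]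
  linarith

lemma CGM.CondIndep.netGain_eq {M : CGM Ω μ} {i j : ι} {S : Finset ι} (h : M.CondIndep i j S)
    (p : ι → ℝ) (lam : ℝ) :
    netGain M p lam i j S = -(lam * ∑ k ∈ Finset.univ.erase j, p k) := by
  simp only [netGain, h.expGain_eq_zero, zero_sub, mul_neg, Finset.sum_neg_distrib]
  rw [← Finset.sum_mul, mul_comm]

/-! ### Drift form of the parameter dynamics -/

variable {p : ι → ℝ} {lam ηγ ηθ : ℝ} {γ θ : ℕ → ι → ι → ℝ}

/-- The mean of the expected gain over the sampled parent sets. -/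
noncomputable def meanGain (M : CGM Ω μ) (γ θ : ι → ι → ℝ) (k i j : ι) : ℝ :=
  ∑ S ∈ (Finset.univ \ {i, j}).powerset, parentProb γ θ i j S * M.expGain k i j S

lemma nllDiff_eq_neg_meanGain (M : CGM Ω μ) (γ θ : ι → ι → ℝ) (k i j : ι) :
    nllDiff M γ θ k i j = -meanGain M γ θ k i j := by
  simp [nllDiff, meanGain]

lemma abs_meanGain_le (M : CGM Ω μ) (γ θ : ι → ι → ℝ) (k i j : ι) :
    |meanGain M γ θ k i j| ≤
      ∑ S ∈ (Finset.univ \ {i, j}).powerset, |M.expGain k i j S| :=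
  abs_weighted_sum_le _ _ _ (fun _ _ => parentProb_nonneg _ _ _ _ _) (sum_parentProb _ _ _ _)

lemma meanGain_nonneg {M : CGM Ω μ} {i j : ι} (h : Condition1 M i j) (γ θ : ι → ι → ℝ) :
    0 ≤ meanGain M γ θ i i j :=
  Finset.sum_nonneg fun S hS => by
    rw [Finset.mem_powerset] at hS
    refine mul_nonneg (parentProb_nonneg _ _ _ _ _) (h S (fun hi => ?_) fun hj => ?_)
    · simpa using hS hi
    · simpa using hS hj

/-- The drift of `θ_ij`. -/
noncomputable def driftθ (M : CGM Ω μ) (p : ι → ℝ) (ηθ : ℝ) (γ θ : ι → ι → ℝ) (i j : ι) : ℝ :=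
  ηθ * (p i * Real.sigmoid (γ i j) * meanGain M γ θ i i j
    - p j * Real.sigmoid (γ j i) * meanGain M γ θ j j i)

/-- The drift of `γ_ij`. -/
noncomputable def driftγ (M : CGM Ω μ) (p : ι → ℝ) (lam ηγ : ℝ) (γ θ : ι → ι → ℝ) (i j : ι) : ℝ :=
  ∑ S ∈ (Finset.univ \ {i, j}).powerset,
    parentProb γ θ i j S * (ηγ * netGain M p lam i j S)

lemma exists_abs_driftγ_le (M : CGM Ω μ) (p : ι → ℝ) (lam ηγ : ℝ) (i j : ι) :
    ∃ R, ∀ γ θ, |driftγ M p lam ηγ γ θ i j| ≤ R :=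
  ⟨_, fun _ _ => abs_weighted_sum_le _ _ _ (fun _ _ => parentProb_nonneg _ _ _ _ _)
    (sum_parentProb _ _ _ _)⟩

lemma exists_abs_driftθ_le (M : CGM Ω μ) (p : ι → ℝ) (ηθ : ℝ) (i j : ι) :
    ∃ R, ∀ γ θ, |driftθ M p ηθ γ θ i j| ≤ R := by
  have hterm : ∀ (q : ℝ) (γ θ : ι → ι → ℝ) (k l : ι),
      |q * Real.sigmoid (γ k l) * meanGain M γ θ k k l| ≤
        |q| * ∑ S ∈ (Finset.univ \ {k, l}).powerset, |M.expGain k k l S| := fun q γ θ k l => by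
    rw [abs_mul, abs_mul, abs_of_pos (Real.sigmoid_pos _)]
    exact mul_le_mul (mul_le_of_le_one_right (abs_nonneg _) (Real.sigmoid_le_one _))
      (abs_meanGain_le M γ θ k k l) (abs_nonneg _) (abs_nonneg _)
  refine ⟨|ηθ| * (|p i| * ∑ S ∈ (Finset.univ \ {i, j}).powerset, |M.expGain i i j S| +
    |p j| * ∑ S ∈ (Finset.univ \ {j, i}).powerset, |M.expGain j j i S|), fun γ θ => ?_⟩
  rw [driftθ, abs_mul]
  exact mul_le_mul_of_nonneg_left ((abs_sub _ _).trans (add_le_add (hterm _ _ _ _ _)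
    (hterm _ _ _ _ _))) (abs_nonneg _)

/-- Since the parent-set probabilities sum to 1, the penalty can be moved inside the average over
parent sets. -/
lemma IsTrajectory.γ_succ {M : CGM Ω μ} (h : IsTrajectory M p lam ηγ ηθ γ θ) {i j : ι}
    (hij : i ≠ j) (t : ℕ) : γ (t + 1) i j = γ t i j +
      dsigmoid (γ t i j) * Real.sigmoid (θ t i j) * driftγ M p lam ηγ (γ t) (θ t) i j := by
  have hsum : ∑ k ∈ Finset.univ.erase j, p k * (nllDiff M (γ t) (θ t) k i j + lam) =
      -∑ S ∈ (Finset.univ \ {i, j}).powerset,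
        parentProb (γ t) (θ t) i j S * netGain M p lam i j S := by
    have h1 : ∀ k, nllDiff M (γ t) (θ t) k i j + lam =
        -∑ S ∈ (Finset.univ \ {i, j}).powerset,
          parentProb (γ t) (θ t) i j S * (M.expGain k i j S - lam) := fun k => by
      simp only [mul_sub, Finset.sum_sub_distrib, ← Finset.sum_mul, sum_parentProb]
      rw [nllDiff_eq_neg_meanGain, meanGain]
      ring
    simp only [h1, netGain, Finset.mul_sum, mul_neg, Finset.sum_neg_distrib]
    rw [Finset.sum_comm]
    congr 1
    exact Finset.sum_congr rfl fun S _ => Finset.sum_congr rfl fun k _ => by ring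
  have hd : driftγ M p lam ηγ (γ t) (θ t) i j = ηγ * ∑ S ∈ (Finset.univ \ {i, j}).powerset,
      parentProb (γ t) (θ t) i j S * netGain M p lam i j S := by
    rw [driftγ, Finset.mul_sum]
    exact Finset.sum_congr rfl fun S _ => by ring
  rw [h.step_γ t i j hij, gradγ, hsum, hd]
  ring

lemma IsTrajectory.θ_succ {M : CGM Ω μ} (h : IsTrajectory M p lam ηγ ηθ γ θ) {i j : ι}
    (hij : i ≠ j) (t : ℕ) : θ (t + 1) i j = θ t i j +
      dsigmoid (θ t i j) * driftθ M p ηθ (γ t) (θ t) i j := by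
  rw [h.step_θ t i j hij, gradθ, driftθ, nllDiff_eq_neg_meanGain, nllDiff_eq_neg_meanGain]
  ring

/-- The upward drift of θ_ji contains the factor σ(γ_ij), which therefore must not decay summably.
-/
lemma IsTrajectory.exists_le_sigmoid_γ {M : CGM Ω μ} (h : IsTrajectory M p lam ηγ ηθ γ θ)
    {i j : ι} (hij : i ≠ j) :
    ∃ c > 0, ∀ t : ℕ, c / ((t : ℝ) + 1) ≤ Real.sigmoid (γ t i j) := by
  obtain ⟨R, hR⟩ := exists_abs_driftγ_le M p lam ηγ i j
  refine exists_le_sigmoid (R := R)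
    (a := fun t => Real.sigmoid (θ t i j) * driftγ M p lam ηγ (γ t) (θ t) i j)
    (fun t => by rw [h.γ_succ hij, mul_assoc]) fun t => ?_
  rw [abs_mul, abs_of_pos (Real.sigmoid_pos _)]
  exact (mul_le_of_le_one_left (abs_nonneg _) (Real.sigmoid_le_one _)).trans (hR _ _)

/-- If `X_j` is a descendant of `X_i` and its intervention eventually reveals the dependence
between them, then `θ_ij` diverges. -/
theorem IsTrajectory.tendsto_θ {M : CGM Ω μ} (h : IsTrajectory M p lam ηγ ηθ γ θ)
    (hp : ∀ i, 0 < p i) (hηθ : 0 < ηθ) {i j : ι} (hij : i ≠ j) (hc : Condition1 M i j)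
    (good : Finset ι → Prop)
    (hbad : ∀ S ∈ (Finset.univ \ {j, i} : Finset ι).powerset, ¬ good S →
      Tendsto (fun t => parentProb (γ t) (θ t) j i S) atTop (𝓝 0))
    (hgood : ∀ S ∈ (Finset.univ \ {j, i} : Finset ι).powerset, good S → M.expGain j j i S < 0) :
    Tendsto (fun t => θ t i j) atTop atTop := by
  obtain ⟨c, hc0, hcg⟩ := exists_pos_le_of_forall_pos _ good (fun S => -M.expGain j j i S)
    fun S hS hg => neg_pos.2 (hgood S hS hg)
  have hev := eventually_lt_weighted_sum _ (fun t S => parentProb (γ t) (θ t) j i S)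
    (fun S => -M.expGain j j i S) good (fun _ _ _ => parentProb_nonneg _ _ _ _ _)
    (fun _ => sum_parentProb _ _ _ _) hbad (half_lt_self hc0) hcg
  obtain ⟨d, hd0, hd⟩ := h.exists_le_sigmoid_γ hij.symm
  have hpj := hp j
  refine tendsto_atTop_of_drift (c := ηθ * (p j * d * (c / 2))) (by positivity) ?_
  filter_upwards [hev] with t ht
  rw [h.θ_succ hij]
  -- By Condition 1 the interventions on `i` can only help, so their contribution is dropped from
  -- the lower bound.
  have h1 := mul_nonneg (mul_nonneg (hp i).le (Real.sigmoid_nonneg (γ t i j)))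
    (meanGain_nonneg hc (γ t) (θ t))
  simp only [mul_neg, Finset.sum_neg_distrib] at ht
  have h2 : d / ((t : ℝ) + 1) * (c / 2) ≤
      Real.sigmoid (γ t j i) * -meanGain M (γ t) (θ t) j j i :=
    mul_le_mul (hd t) ht.le (by positivity) (Real.sigmoid_nonneg _)
  have h3 := mul_le_mul_of_nonneg_left h2 hpj.le
  have h4 : ηθ * (p j * (d / ((t : ℝ) + 1) * (c / 2))) ≤ driftθ M p ηθ (γ t) (θ t) i j := by
    refine mul_le_mul_of_nonneg_left ?_ hηθ.le
    linarith
  have h5 : ηθ * (p j * d * (c / 2)) / ((t : ℝ) + 1) =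
      ηθ * (p j * (d / ((t : ℝ) + 1) * (c / 2))) := by ring
  rw [h5]
  linarith [mul_le_mul_of_nonneg_left h4 (dsigmoid_pos (θ t i j)).le]

variable [∀ i, SigmaFinite (μ i)]

/-- The probabilities of all edges from descendants to ancestors vanish. -/
theorem IsTrajectory.edgeProb_anticausal {M : CGM Ω μ} (h : IsTrajectory M p lam ηγ ηθ γ θ)
    (hfin : M.FiniteGains) (hp : ∀ i, 0 < p i) (hlam : 0 < lam) (hηγ : 0 < ηγ) (hηθ : 0 < ηθ)
    (hc : ∀ i j, M.Ancestor i j → Condition1 M i j) {i j : ι} (hij : M.Ancestor i j) :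
    Tendsto (fun t => edgeProb (γ t) (θ t) j i) atTop (𝓝 0) := by
  -- Descendants `k` of `j` are also descendants of `i`, so the induction hypothesis already removes
  -- the edges from `k` to `i`.
  induction j using M.wellFounded_descendant.induction generalizing i with
  | _ j ih =>
  have hne := M.ne_of_ancestor hij
  obtain ⟨R₁, hR₁⟩ := exists_abs_driftγ_le M p lam ηγ j i
  obtain ⟨R₂, hR₂⟩ := exists_abs_driftθ_le M p ηθ j i
  set R := max R₁ R₂
  have hR0 : 0 ≤ R := ((abs_nonneg _).trans (hR₁ 0 0)).trans (le_max_left _ _)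
  set U := (Finset.univ \ {j, i} : Finset ι).powerset with hU
  have hmem : ∀ S ∈ U, j ∉ S ∧ i ∉ S := fun S hS => by
    rw [hU, Finset.mem_powerset] at hS
    exact ⟨fun h => by simpa using hS h, fun h => by simpa using hS h⟩
  set P := ∑ k ∈ Finset.univ.erase i, p k
  have hP : 0 < P := sum_erase_pos hp hne.symm
  set δ := Real.exp (-R) * (ηγ * (lam * P)) with hδ
  have hδ0 : 0 < δ := by positivity
  set D : Finset ι → ℝ := fun S => dilate R (ηγ * netGain M p lam j i S) with hD
  set q : Finset ι → ℝ := fun S => Real.exp (-R) * (ηθ * p j * -M.expGain j j i S) with hq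
  -- Large enough that, for each set with negative gain, the fall of θ outweighs a possible rise of
  -- γ by δ. Independent sets contribute exactly -δ whatever `K` is; their terms here are 0 because
  -- `q S` is 0.
  set K := ∑ S ∈ U, |D S + δ| / |q S| with hK
  have hK0 : 0 ≤ K := Finset.sum_nonneg fun _ _ => by positivity
  have hgood : ∀ S ∈ U, S ⊆ M.nonDesc j →
      δ ≤ -(K * dilate R (ηθ * p j * M.expGain j j i S) + D S) := fun S hS hSn => by
    obtain ⟨-, hiS⟩ := hmem S hS
    rcases M.expGain_anticausal hfin hne hiS
      (Finset.insert_subset (M.nonDesc_of_ancestor hij) hSn) with hneg | hci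
    · have hq0 : 0 < q S :=
        mul_pos (Real.exp_pos _) (mul_pos (mul_pos hηθ (hp j)) (neg_pos.2 hneg))
      have hdil : dilate R (ηθ * p j * M.expGain j j i S) = -q S := by
        rw [dilate_of_nonpos hR0 (mul_nonpos_of_nonneg_of_nonpos
          (mul_pos hηθ (hp j)).le hneg.le), hq]
        ring
      have hKS : |D S + δ| / |q S| ≤ K :=
        Finset.single_le_sum (f := fun S => |D S + δ| / |q S|) (fun _ _ => by positivity) hS
      rw [abs_of_pos hq0, div_le_iff₀ hq0] at hKS
      rw [hdil]
      linarith [le_abs_self (D S + δ)]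
    · have hDS : D S = -δ := by
        simp only [hD]
        rw [hci.netGain_eq, dilate_of_nonpos hR0 (by
          have : 0 < ηγ * (lam * P) := by positivity
          linarith), hδ]
        ring
      rw [hci.expGain_eq_zero, hDS]
      simp [dilate]
  have hev := eventually_lt_weighted_sum U (fun t S => parentProb (γ t) (θ t) j i S)
    (fun S => -(K * dilate R (ηθ * p j * M.expGain j j i S) + D S)) (fun S => S ⊆ M.nonDesc j)
    (fun _ _ _ => parentProb_nonneg _ _ _ _ _) (fun _ => sum_parentProb _ _ _ _)
    (fun S hS hbad => by
      obtain ⟨k, hkS, hk⟩ := Finset.not_subset.1 hbad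
      rw [M.mem_nonDesc] at hk
      have hjk : M.Ancestor j k := by
        by_contra hn
        exact hk ⟨fun e => (hmem S hS).1 (e ▸ hkS), hn⟩
      exact parentProb_tendsto_zero_of_mem j hkS (ih k hjk (hij.trans hjk)))
    (half_lt_self hδ0) hgood
  refine tendsto_sigmoid_mul_sigmoid_zero (R := R) (δ := δ / 2)
    (b' := fun t => ηθ * p j * meanGain M (γ t) (θ t) j j i) hK0 (half_pos hδ0)
    (h.γ_succ hne.symm) (h.θ_succ hne.symm) (fun t => (hR₁ _ _).trans (le_max_left _ _))
    (fun t => (hR₂ _ _).trans (le_max_right _ _)) (fun t => ?_) ?_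
  · have h1 := mul_nonneg (mul_nonneg (hp i).le (Real.sigmoid_nonneg (γ t i j)))
      (meanGain_nonneg (hc i j hij) (γ t) (θ t))
    have h2 := mul_nonneg hηθ.le h1
    simp only [driftθ]
    linarith
  · filter_upwards [hev] with t ht
    have hw : ∀ S ∈ U, 0 ≤ parentProb (γ t) (θ t) j i S := fun _ _ => parentProb_nonneg _ _ _ _ _
    have h1 := dilate_sum_le U R _ (fun S => ηθ * p j * M.expGain j j i S) hw
    have h2 := dilate_sum_le U R _ (fun S => ηγ * netGain M p lam j i S) hw
    have h3 : ηθ * p j * meanGain M (γ t) (θ t) j j i =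
        ∑ S ∈ U, parentProb (γ t) (θ t) j i S * (ηθ * p j * M.expGain j j i S) := by
      rw [meanGain, Finset.mul_sum]
      exact Finset.sum_congr rfl fun S _ => by ring
    rw [← h3] at h1
    have h4 := mul_le_mul_of_nonneg_left h1 hK0
    simp only [mul_neg, Finset.sum_neg_distrib, mul_add, Finset.sum_add_distrib] at ht
    rw [Finset.mul_sum] at h4
    have h5 : ∑ S ∈ U, K * (parentProb (γ t) (θ t) j i S *
        dilate R (ηθ * p j * M.expGain j j i S)) = ∑ S ∈ U, parentProb (γ t) (θ t) j i S *
        (K * dilate R (ηθ * p j * M.expGain j j i S)) :=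
      Finset.sum_congr rfl fun S _ => by ring
    rw [h5] at h4
    simp only [driftγ]
    linarith

end Model

end ENCO

/-! ### Convergence to the causal graph -/

open ENCO in
theorem theorem1 {ι : Type*} [Fintype ι] [DecidableEq ι]
    {Ω : ι → Type*} [∀ i, MeasurableSpace (Ω i)]
    {μ : ∀ i, Measure (Ω i)} [∀ i, SigmaFinite (μ i)]
    (M : ENCO.CGM Ω μ) (hfin : M.FiniteGains)
    (p : ι → ℝ) (hp : ∀ i, 0 < p i) (hp1 : ∑ i, p i = 1)
    (lam : ℝ) (hlam : 0 < lam) (ηγ ηθ : ℝ) (hηγ : 0 < ηγ) (hηθ : 0 < ηθ)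
    (γ θ : ℕ → ι → ι → ℝ) (htraj : ENCO.IsTrajectory M p lam ηγ ηθ γ θ)
    (hedge : ∀ i j, M.Edge i j →
      ENCO.Condition1 M i j ∧ ENCO.Condition2 M (γ 0) (θ 0) i j ∧ ENCO.Condition3 M p lam i j)
    (hanc : ∀ i j, M.Ancestor i j → ¬ M.Edge i j →
      ENCO.Condition1 M i j ∧ ENCO.Condition2 M (γ 0) (θ 0) i j) :
    (∀ i j, M.Edge i j →
      Tendsto (fun t => Real.sigmoid (θ t i j)) atTop (𝓝 1) ∧
      Tendsto (fun t => Real.sigmoid (γ t i j)) atTop (𝓝 1)) ∧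
    (∀ i j, i ≠ j → ¬ M.Edge i j →
      Tendsto (fun t => ENCO.edgeProb (γ t) (θ t) i j) atTop (𝓝 0)) ∧
    (∀ i j, M.Ancestor i j → ¬ M.CondIndep i j (M.pa i) →
      Tendsto (fun t => Real.sigmoid (θ t i j)) atTop (𝓝 1)) ∧
    (∀ᶠ t in atTop, ∀ i j, ENCO.Predicted (γ t) (θ t) i j ↔ M.Edge i j) := by
  have hc : ∀ i j, M.Ancestor i j → Condition1 M i j := fun i j hij => by
    by_cases he : M.Edge i j
    exacts [(hedge i j he).1, (hanc i j hij he).1]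
  have hrev : ∀ i j, M.Ancestor i j → Tendsto (fun t => edgeProb (γ t) (θ t) j i) atTop (𝓝 0) :=
    fun i j hij => htraj.edgeProb_anticausal hfin hp hlam hηγ hηθ hc hij
  have hmem : ∀ {i j : ι} {S : Finset ι}, S ∈ (Finset.univ \ {i, j} : Finset ι).powerset →
      i ∉ S ∧ j ∉ S := fun {i j S} hS => by
    rw [Finset.mem_powerset] at hS
    exact ⟨fun h => by simpa using hS h, fun h => by simpa using hS h⟩
  -- The target `a` will be `j` itself for the γ-updates and an ancestor of `j` for the θ-updates.
  have hnd : ∀ (i j a : ι) (S : Finset ι), j ∉ S → (∀ k, M.Ancestor j k → M.Ancestor a k) →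
      ¬ S ⊆ M.nonDesc j → Tendsto (fun t => parentProb (γ t) (θ t) i a S) atTop (𝓝 0) :=
    fun i j a S hjS hk hS => by
      obtain ⟨k, hkS, hkn⟩ := Finset.not_subset.1 hS
      rw [M.mem_nonDesc] at hkn
      have hjk : M.Ancestor j k := by
        by_contra hn
        exact hkn ⟨fun e => hjS (e ▸ hkS), hn⟩
      exact parentProb_tendsto_zero_of_mem i hkS (hrev a k (hk k hjk))
  have hθ : ∀ i j, M.Edge i j → Tendsto (fun t => θ t i j) atTop atTop := fun i j he => by
    have hij : M.Ancestor i j := Relation.TransGen.single he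
    have hne := M.ne_of_ancestor hij
    refine htraj.tendsto_θ hp hηθ hne (hc i j hij) (fun S => S ⊆ M.nonDesc j)
      (fun S hS hbad => hnd j j i S (hmem hS).1 (fun k hk => hij.trans hk) hbad)
      fun S hS hg => ?_
    refine (M.expGain_anticausal hfin hne (hmem hS).2
      (Finset.insert_subset (M.nonDesc_of_ancestor hij) hg)).resolve_right fun hci => ?_
    -- Conditional independence would leave only the penalty, making the net gain negative, against
    -- Condition 3.
    have h1 := (hedge i j he).2.2.netGain_pos hp hne (hmem hS).2 hg
    rw [hci.symm.netGain_eq] at h1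
    linarith [mul_pos hlam (sum_erase_pos hp hne)]
  have hsθ : ∀ i j, M.Edge i j → Tendsto (fun t => Real.sigmoid (θ t i j)) atTop (𝓝 1) :=
    fun i j he => Real.tendsto_sigmoid_atTop.comp (hθ i j he)
  have hsγ : ∀ i j, M.Edge i j → Tendsto (fun t => Real.sigmoid (γ t i j)) atTop (𝓝 1) :=
      fun i j he => by
    have hne := M.ne_of_ancestor (Relation.TransGen.single he)
    obtain ⟨c, hc0, hcg⟩ := exists_pos_le_of_forall_pos
      (Finset.univ \ {i, j} : Finset ι).powerset (fun S => S ⊆ M.nonDesc j)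
      (fun S => ηγ * netGain M p lam i j S) fun S hS hg =>
        mul_pos hηγ ((hedge i j he).2.2.netGain_pos hp hne (hmem hS).1 hg)
    have hev := eventually_lt_weighted_sum _ (fun t S => parentProb (γ t) (θ t) i j S)
      (fun S => ηγ * netGain M p lam i j S) (fun S => S ⊆ M.nonDesc j)
      (fun _ _ _ => parentProb_nonneg _ _ _ _ _) (fun _ => sum_parentProb _ _ _ _)
      (fun S hS hbad => hnd i j j S (hmem hS).2 (fun _ hk => hk) hbad) (half_lt_self hc0) hcg
    refine Real.tendsto_sigmoid_atTop.comp
      (tendsto_atTop_of_drift (c := 1 / 2 * (c / 2)) (by positivity) ?_)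
    filter_upwards [hev, (hsθ i j he).eventually (lt_mem_nhds one_half_lt_one)] with t ht hs
    rw [htraj.γ_succ hne, mul_assoc]
    have h1 : 1 / 2 * (c / 2) ≤
        Real.sigmoid (θ t i j) * driftγ M p lam ηγ (γ t) (θ t) i j :=
      mul_le_mul hs.le ht.le (by positivity) (Real.sigmoid_nonneg _)
    -- The drift is bounded below by a constant here, more than the order 1/t that suffices for
    -- divergence.
    have h2 : 1 / 2 * (c / 2) / ((t : ℝ) + 1) ≤ 1 / 2 * (c / 2) :=
      div_le_self (by positivity) (by linarith [Nat.cast_nonneg (α := ℝ) t])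
    linarith [mul_le_mul_of_nonneg_left (h2.trans h1) (dsigmoid_pos (γ t i j)).le]
  have hone : ∀ i j, M.Edge i j → Tendsto (fun t => edgeProb (γ t) (θ t) i j) atTop (𝓝 1) :=
    fun i j he => by simpa [edgeProb] using (hsγ i j he).mul (hsθ i j he)
  have hpa : ∀ (i j : ι) (S : Finset ι), ¬ M.Edge i j → ¬ M.pa j ⊆ S →
      Tendsto (fun t => parentProb (γ t) (θ t) i j S) atTop (𝓝 0) := fun i j S he hS => by
    obtain ⟨k, hk, hkS⟩ := Finset.not_subset.1 hS
    rw [M.mem_pa] at hk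
    refine parentProb_tendsto_zero_of_notMem hkS ?_
      (M.ne_of_ancestor (Relation.TransGen.single hk)) (hone k j hk)
    rintro rfl
    exact he hk
  have hzero : ∀ i j, i ≠ j → ¬ M.Edge i j →
      Tendsto (fun t => edgeProb (γ t) (θ t) i j) atTop (𝓝 0) := fun i j hne he => by
    by_cases hji : M.Ancestor j i
    · exact hrev j i hji
    have hi : i ∈ M.nonDesc j := M.mem_nonDesc.2 ⟨hne, hji⟩
    set P := ∑ k ∈ Finset.univ.erase j, p k
    have hP : 0 < P := sum_erase_pos hp hne
    have hL : 0 < ηγ * (lam * P) := by positivity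
    have hev := eventually_lt_weighted_sum _ (fun t S => parentProb (γ t) (θ t) i j S)
      (fun S => -(ηγ * netGain M p lam i j S)) (fun S => M.pa j ⊆ S ∧ S ⊆ M.nonDesc j)
      (fun _ _ _ => parentProb_nonneg _ _ _ _ _) (fun _ => sum_parentProb _ _ _ _)
      (fun S hS hbad => by
        by_cases hS' : M.pa j ⊆ S
        · exact hnd i j j S (hmem hS).2 (fun _ hk => hk) fun h => hbad ⟨hS', h⟩
        · exact hpa i j S he hS') (half_lt_self hL)
      (fun S _ hg => by
        rw [(M.condIndep_of_pa_subset hg.1 hg.2 hi).netGain_eq]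
        linarith)
    obtain ⟨R₁, hR₁⟩ := exists_abs_driftγ_le M p lam ηγ i j
    obtain ⟨R₂, hR₂⟩ := exists_abs_driftθ_le M p ηθ i j
    have hR0 : 0 ≤ max R₁ R₂ := ((abs_nonneg _).trans (hR₁ 0 0)).trans (le_max_left _ _)
    -- The drift of γ alone is negative, so θ gets weight 0; `b'` is chosen only to satisfy its
    -- defining inequality with equality.
    refine tendsto_sigmoid_mul_sigmoid_zero (K := 0) (R := max R₁ R₂)
      (δ := Real.exp (-max R₁ R₂) * (ηγ * (lam * P) / 2))
      (b' := fun t => driftθ M p ηθ (γ t) (θ t) i j / Real.sigmoid (γ t i j)) le_rfl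
      (by positivity) (htraj.γ_succ hne) (htraj.θ_succ hne)
      (fun t => (hR₁ _ _).trans (le_max_left _ _)) (fun t => (hR₂ _ _).trans (le_max_right _ _))
      (fun t => (mul_div_cancel₀ _ (Real.sigmoid_pos _).ne').ge) ?_
    filter_upwards [hev] with t ht
    simp only [mul_neg, Finset.sum_neg_distrib] at ht
    have h1 : driftγ M p lam ηγ (γ t) (θ t) i j ≤ -(ηγ * (lam * P) / 2) := by
      simp only [driftγ]
      linarith
    rw [zero_mul, zero_add]
    refine (dilate_mono _ h1).trans ?_
    rw [dilate_of_nonpos hR0 (by linarith), mul_neg]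
  refine ⟨fun i j he => ⟨hsθ i j he, hsγ i j he⟩, hzero, fun i j hij hci => ?_, ?_⟩
  · have hne := M.ne_of_ancestor hij
    have hji : ¬ M.Edge j i := fun he => M.acyclic i (hij.tail he)
    refine Real.tendsto_sigmoid_atTop.comp (htraj.tendsto_θ hp hηθ hne (hc i j hij)
      -- All true edges into `i` have probability tending to 1 and all others to 0, so the only
      -- parent set that matters in the limit is the true one.
      (fun S => S = M.pa i) (fun S hS hbad => ?_) fun S hS hg => ?_)
    · by_cases hS' : M.pa i ⊆ S
      · obtain ⟨k, hkS, hk⟩ := Finset.not_subset.1 fun h => hbad (h.antisymm hS')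
        rw [M.mem_pa] at hk
        exact parentProb_tendsto_zero_of_mem j hkS
          (hzero k i (fun e => (hmem hS).2 (e ▸ hkS)) hk)
      · exact hpa j i S hji hS'
    · subst hg
      refine (M.expGain_anticausal hfin hne (hmem hS).2 (Finset.insert_subset
        (M.nonDesc_of_ancestor hij) fun k hk => M.nonDesc_of_ancestor
          (hij.head (M.mem_pa.1 hk)))).resolve_right fun h => hci h.symm
  · rw [eventually_all]
    intro i
    rw [eventually_all]
    intro j
    by_cases he : M.Edge i j
    · filter_upwards [(hsθ i j he).eventually (lt_mem_nhds one_half_lt_one),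
        (hsγ i j he).eventually (lt_mem_nhds one_half_lt_one)] with t h1 h2
      exact iff_of_true ⟨M.ne_of_ancestor (Relation.TransGen.single he), h2, h1⟩ he
    · by_cases hne : i = j
      · exact .of_forall fun t => iff_of_false (fun h => h.1 hne) he
      -- A returned edge has both factors above 1/2, hence probability above 1/4.
      · filter_upwards [(hzero i j hne he).eventually
          (gt_mem_nhds (show (0 : ℝ) < 1 / 2 * (1 / 2) by norm_num))] with t ht
        refine iff_of_false (fun h => ?_) he
        have := mul_le_mul h.2.1.le h.2.2.le (by norm_num) (Real.sigmoid_nonneg _)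
        exact absurd ht (not_lt.2 this)
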